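/- Let $N\ge 1$, $T>0$, $0<\rho\le 1$. Let $A(D)=\sum_{|\alpha|=m}a_\alpha D^\alpha$, $D_j=-i\,\partial/\partial x_j$, be a homogeneous differential operator of order $m$ with constant (complex) coefficients that is elliptic ($A(\xi)=\sum_{|\alpha|=m}a_\alpha\xi^\alpha\neq0$ for $0\ne\xi\in\mathbb R^N$), symmetric ($(A(D)g,h)=(g,A(D)h)$) and positive ($(A(D)g,g)\ge 0$) on smooth functions that are $2\pi$-periodic in each variable, where $(\cdot,\cdot)$ is the scalar product of $L_2(\mathbb T^N)$, $\mathbb T^N=(-\pi,\pi]^N$. For $0<\rho<1$ let $$D_t^\rho g(t)=\frac1{\Gamma(1-\rho)}\int_0^t\frac{g'(\tau)\,d\tau}{(t-\tau)^\rho}$$ be the Caputo derivative, which is said to exist at $t$ if $g$ is absolutely continuous on $[0,t]$ and the integral converges (as a Lebesgue integral); for $\rho=1$ let $D_t^\rho=d/dt$ (one-sided at $t=T$). Let $\varphi,\Psi:\mathbb R^N\to\mathbb C$ be continuous and $2\pi$-periodic in each variable. A classical solution of the inverse problem is a pair $\{u(x,t),f(x)\}$ of complex-valued functions, $2\pi$-periodic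 in each $x_j$, such that $f\in C(\mathbb T^N)$, $u\in C(\mathbb T^N\times[0,T])$, $u(\cdot,t)\in C^m(\mathbb R^N)$ for $0<t\le T$, $D_t^\rho u$ exists on $\mathbb T^N\times(0,T]$, $D_t^\rho u,\,A(D)u\in C(\mathbb T^N\times(0,T])$, and $$D_t^\rho u(x,t)+A(D)u(x,t)=f(x)\quad(x\in\mathbb T^N,\ 0<t\le T),\qquad u(x,0)=\varphi(x),\qquad u(x,T)=\Psi(x)\quad(x\in\mathbb T^N).$$ Then there is at most one classical solution: if $\{u_1,f_1\}$ and $\{u_2,f_2\}$ are classical solutions with the same $\varphi$ and $\Psi$, then $u_1=u_2$ on $\mathbb T^N\times[0,T]$ and $f_1=f_2$ on $\mathbb T^N$. -/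

import Mathlib

open MeasureTheory Set
open scoped ContDiff

noncomputable section

namespace Subdiffusion

/-- `g` is `2π`-periodic in each of the variables `x₁, …, x_N`; such functions are the functions
on the torus `𝕋^N`. -/
def TorusPeriodic {N : ℕ} (g : (Fin N → ℝ) → ℂ) : Prop :=
  ∀ j : Fin N, Function.Periodic g (Pi.single j (2 * Real.pi))

/-- The fundamental cell `(-π, π]^N`. -/
def cell (N : ℕ) : Set (Fin N → ℝ) :=
  Set.univ.pi fun _ => Set.Ioc (-Real.pi) Real.pi

/-- The scalar product of `L₂(𝕋^N)`. -/
def torusInner {N : ℕ} (g h : (Fin N → ℝ) → ℂ) : ℂ :=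
  ∫ x in cell N, g x * (starRingEnd ℂ) (h x)

/-- `D_j = -i ∂/∂x_j`, so that `D_j e^{inx} = n_j e^{inx}`. -/
def dOp {N : ℕ} (j : Fin N) (g : (Fin N → ℝ) → ℂ) : (Fin N → ℝ) → ℂ :=
  fun x => -Complex.I * lineDeriv ℝ g x (Pi.single j 1)

/-- `D^α = D_1^{α_1} ⋯ D_N^{α_N}`. -/
def dPow {N : ℕ} (α : Fin N → ℕ) (g : (Fin N → ℝ) → ℂ) : (Fin N → ℝ) → ℂ :=
  (List.finRange N).foldr (fun j h => (dOp j)^[α j] h) g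

/-- The multi-indices `α` with `|α| = m`. -/
def multiIndices (N m : ℕ) : Finset (Fin N → ℕ) :=
  Finset.piAntidiag Finset.univ m

/-- The homogeneous operator `A(D) = ∑_{|α| = m} a_α D^α` with constant coefficients. -/
def diffOp {N : ℕ} (m : ℕ) (a : (Fin N → ℕ) → ℂ) (g : (Fin N → ℝ) → ℂ) : (Fin N → ℝ) → ℂ :=
  fun x => ∑ α ∈ multiIndices N m, a α * dPow α g x

/-- The symbol `A(ξ) = ∑_{|α| = m} a_α ξ^α`. -/
def symbol {N : ℕ} (m : ℕ) (a : (Fin N → ℕ) → ℂ) (ξ : Fin N → ℝ) : ℂ :=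
  ∑ α ∈ multiIndices N m, a α * ∏ j, (ξ j : ℂ) ^ α j

/-- `A(D)` is elliptic: its symbol has no real zeros other than `0`. -/
def IsElliptic {N : ℕ} (m : ℕ) (a : (Fin N → ℕ) → ℂ) : Prop :=
  ∀ ξ : Fin N → ℝ, ξ ≠ 0 → symbol m a ξ ≠ 0

/-- `A(D)` is symmetric: `(A g, h) = (g, A h)` for smooth periodic `g`, `h`. -/
def IsSymmetricOp {N : ℕ} (m : ℕ) (a : (Fin N → ℕ) → ℂ) : Prop :=
  ∀ g h : (Fin N → ℝ) → ℂ, ContDiff ℝ ∞ g → TorusPeriodic g → ContDiff ℝ ∞ h → TorusPeriodic h →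
    torusInner (diffOp m a g) h = torusInner g (diffOp m a h)

/-- `A(D)` is positive: `(A g, g) ≥ 0` for smooth periodic `g`. (Equality occurs for constant `g`
as soon as `m ≥ 1`.) -/
def IsPositiveOp {N : ℕ} (m : ℕ) (a : (Fin N → ℕ) → ℂ) : Prop :=
  ∀ g : (Fin N → ℝ) → ℂ, ContDiff ℝ ∞ g → TorusPeriodic g →
    0 ≤ (torusInner (diffOp m a g) g).re

/-- The Caputo derivative of order `ρ ∈ (0, 1]` at the time `t ∈ (0, T]` of a function given on
`[0, T]`. For `ρ = 1` it is the ordinary derivative (one-sided at `T`). -/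
def caputoDeriv (ρ T : ℝ) (g : ℝ → ℂ) (t : ℝ) : ℂ :=
  if ρ = 1 then derivWithin g (Set.Icc 0 T) t
  else ((1 / Real.Gamma (1 - ρ) : ℝ) : ℂ) * ∫ τ in (0 : ℝ)..t, ((t - τ) ^ (-ρ) : ℝ) • deriv g τ

/-- The Caputo derivative of order `ρ` of `g` exists at `t`: for `ρ = 1`, `g` is differentiable
at `t`; for `ρ < 1`, `g` is absolutely continuous on `[0, t]` (so that `g'` is meaningful under the
integral sign) and the defining integral converges. A function that is continuous on `[0, t]`,
differentiable at every point of `(0, t)` and has a convergent defining integral is absolutely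
continuous on `[0, t]`, so it satisfies this condition. -/
def CaputoDifferentiableAt (ρ T : ℝ) (g : ℝ → ℂ) (t : ℝ) : Prop :=
  if ρ = 1 then DifferentiableWithinAt ℝ g (Set.Icc 0 T) t
  else AbsolutelyContinuousOnInterval g 0 t ∧
    IntervalIntegrable (fun τ => ((t - τ) ^ (-ρ) : ℝ) • deriv g τ) volume 0 t

/-- `{u, f}` is a classical solution of the inverse problem
`D_t^ρ u + A(D) u = f` on `𝕋^N × (0, T]`, `u(x, 0) = φ(x)`, `u(x, T) = Ψ(x)`. Only the values of
`u` at times in `[0, T]` matter. -/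
structure IsClassicalSolution {N : ℕ} (m : ℕ) (a : (Fin N → ℕ) → ℂ) (ρ T : ℝ)
    (φ Ψ : (Fin N → ℝ) → ℂ) (u : (Fin N → ℝ) → ℝ → ℂ) (f : (Fin N → ℝ) → ℂ) : Prop where
  f_continuous : Continuous f
  f_periodic : TorusPeriodic f
  u_continuous : ContinuousOn (fun p : (Fin N → ℝ) × ℝ => u p.1 p.2) (Set.univ ×ˢ Set.Icc 0 T)
  u_periodic : ∀ t ∈ Set.Icc 0 T, TorusPeriodic fun x => u x t
  caputo_exists : ∀ x, ∀ t ∈ Set.Ioc 0 T, CaputoDifferentiableAt ρ T (u x) t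
  caputo_continuous :
    ContinuousOn (fun p : (Fin N → ℝ) × ℝ => caputoDeriv ρ T (u p.1) p.2)
      (Set.univ ×ˢ Set.Ioc 0 T)
  u_contDiff : ∀ t ∈ Set.Ioc 0 T, ContDiff ℝ m fun x => u x t
  diffOp_continuous :
    ContinuousOn (fun p : (Fin N → ℝ) × ℝ => diffOp m a (fun y => u y p.2) p.1)
      (Set.univ ×ˢ Set.Ioc 0 T)
  equation : ∀ x, ∀ t ∈ Set.Ioc 0 T,
    caputoDeriv ρ T (u x) t + diffOp m a (fun y => u y t) x = f x
  initial : ∀ x, u x 0 = φ x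
  final : ∀ x, u x T = Ψ x

end Subdiffusion

end

/-
For each character `e^{inx}` the coefficient `y` of `u (·, t)` satisfies the scalar equation
`y t = y 0 + I^ρ (c - lam y) t`, where `c` is the coefficient of `f`, `lam = A(n)` is real because
`A(D)` is symmetric, and `I^ρ` is the Riemann–Liouville integral. For the difference of two
solutions `y` vanishes at both ends of `[0, T]`. If `c ≠ 0`, we may normalise `c` to be positive;
then `c - lam y` cannot reach a first zero, so it is positive on `[0, T]`, and
`y T = I^ρ (c - lam y) T > 0`, a contradiction. Hence `c = 0`, and then `y = 0` by Gronwall.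

At `t = 0` neither `D_t^ρ u` nor `A(D) u` is controlled. The equation is therefore integrated over
`[ε, t]`, which involves only `I^{1-ρ} (u - u (·, 0))` at the end points, a function that is
continuous up to `t = 0`.
-/

noncomputable section

namespace Subdiffusion

open Filter Topology

/-! ### Riemann–Liouville integrals -/

section FractionalIntegral

variable {E : Type*} [NormedAddCommGroup E] [NormedSpace ℝ E]

/-- The Riemann–Liouville integral of order `a ≥ 0` with base point `0`. The case `a = 0`, where
the integral formula is meaningless (and `Real.Gamma 0 = 0`), is the identity; this makes the
Caputo equation of order `ρ = 1` a special case of the one of order `ρ ≤ 1`. -/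
def fracInt (a : ℝ) (f : ℝ → E) (t : ℝ) : E :=
  if a = 0 then f t else (Real.Gamma a)⁻¹ • ∫ s in (0 : ℝ)..t, ((t - s) ^ (a - 1) : ℝ) • f s

lemma fracInt_zero (f : ℝ → E) : fracInt 0 f = f := by
  ext t; simp [fracInt]

lemma fracInt_of_ne {a : ℝ} (ha : a ≠ 0) (f : ℝ → E) (t : ℝ) :
    fracInt a f t = (Real.Gamma a)⁻¹ • ∫ s in (0 : ℝ)..t, ((t - s) ^ (a - 1) : ℝ) • f s :=
  if_neg ha

lemma fracInt_one (f : ℝ → E) (t : ℝ) : fracInt 1 f t = ∫ s in (0 : ℝ)..t, f s := by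
  simp [fracInt]

lemma fracInt_congr {a t : ℝ} (ht : 0 ≤ t) {f g : ℝ → E} (h : EqOn f g (Icc 0 t)) :
    fracInt a f t = fracInt a g t := by
  unfold fracInt
  rw [h ⟨ht, le_rfl⟩]
  congr 2
  refine intervalIntegral.integral_congr fun s hs => ?_
  rw [uIcc_of_le ht] at hs
  simp only [h hs]

lemma intervalIntegrable_rpow_sub {a : ℝ} (ha : 0 < a) (b t : ℝ) :
    IntervalIntegrable (fun s => (t - s) ^ (a - 1)) volume b t := by
  have := (intervalIntegral.intervalIntegrable_rpow' (a := 0) (b := t - b) (r := a - 1)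
    (by linarith)).comp_sub_left t
  simpa using this.symm

lemma intervalIntegrable_rpow_sub_smul {a t : ℝ} (ha : 0 < a) (ht : 0 ≤ t) {f : ℝ → E}
    (hf : ContinuousOn f (Icc 0 t)) :
    IntervalIntegrable (fun s => (t - s) ^ (a - 1) • f s) volume 0 t :=
  (intervalIntegrable_rpow_sub ha 0 t).smul_continuousOn (by rwa [uIcc_of_le ht])

lemma integral_rpow_sub {a : ℝ} (ha : 0 < a) (b t : ℝ) :
    ∫ s in b..t, (t - s) ^ (a - 1) = (t - b) ^ a / a := by
  rw [intervalIntegral.integral_comp_sub_left (fun x : ℝ => x ^ (a - 1)) t, sub_self,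
    integral_rpow (Or.inl (by linarith)), sub_add_cancel, Real.zero_rpow ha.ne', sub_zero]

lemma fracInt_sub {a t : ℝ} (ha : 0 ≤ a) (ht : 0 ≤ t) {f g : ℝ → E}
    (hf : ContinuousOn f (Icc 0 t)) (hg : ContinuousOn g (Icc 0 t)) :
    fracInt a (fun s => f s - g s) t = fracInt a f t - fracInt a g t := by
  obtain rfl | ha := ha.eq_or_lt
  · simp only [fracInt_zero]
  · simp only [fracInt_of_ne ha.ne', smul_sub]
    rw [intervalIntegral.integral_sub (intervalIntegrable_rpow_sub_smul ha ht hf)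
      (intervalIntegrable_rpow_sub_smul ha ht hg), smul_sub]

lemma map_fracInt {F : Type*} [NormedAddCommGroup F] [NormedSpace ℝ F]
    [CompleteSpace E] [CompleteSpace F] (L : E →L[ℝ] F) {a t : ℝ} (ha : 0 ≤ a) (ht : 0 ≤ t)
    {f : ℝ → E} (hf : ContinuousOn f (Icc 0 t)) :
    L (fracInt a f t) = fracInt a (fun s => L (f s)) t := by
  obtain rfl | ha := ha.eq_or_lt
  · simp only [fracInt_zero]
  · simp only [fracInt_of_ne ha.ne', map_smul,
      ← L.intervalIntegral_comp_comm (intervalIntegrable_rpow_sub_smul ha ht hf)]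

lemma integral_beta_kernel {a b τ t : ℝ} (ha : 0 < a) (hb : 0 < b) (h : τ < t) :
    ∫ s in τ..t, (t - s) ^ (a - 1) * (s - τ) ^ (b - 1)
      = ProbabilityTheory.beta a b * (t - τ) ^ (a + b - 1) := by
  have h0 : 0 < t - τ := sub_pos.2 h
  have hshift : ∫ s in τ..t, (t - s) ^ (a - 1) * (s - τ) ^ (b - 1)
      = ∫ x in (0 : ℝ)..(t - τ), x ^ (b - 1) * ((t - τ) - x) ^ (a - 1) := by
    rw [← sub_self τ, ← intervalIntegral.integral_comp_sub_right
      (fun x : ℝ => x ^ (b - 1) * ((t - τ) - x) ^ (a - 1)) τ]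
    simp only [sub_sub_sub_cancel_right, mul_comm]
  have hbeta := congrArg Complex.re (Complex.betaIntegral_scaled (b : ℂ) (a : ℂ) h0)
  have hreal : ∫ x in (0 : ℝ)..(t - τ),
        (x : ℂ) ^ ((b : ℂ) - 1) * (((t - τ : ℝ) : ℂ) - x) ^ ((a : ℂ) - 1)
      = ((∫ x in (0 : ℝ)..(t - τ), x ^ (b - 1) * ((t - τ) - x) ^ (a - 1) : ℝ) : ℂ) := by
    rw [← intervalIntegral.integral_ofReal]
    refine intervalIntegral.integral_congr fun x hx => ?_
    rw [uIcc_of_le h0.le] at hx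
    rw [Complex.ofReal_mul, Complex.ofReal_cpow hx.1, Complex.ofReal_cpow (by linarith [hx.2])]
    push_cast
    rfl
  rw [hreal, Complex.ofReal_re, show (b : ℂ) + a - 1 = ((a + b - 1 : ℝ) : ℂ) by push_cast; ring,
    ← Complex.ofReal_cpow h0.le, Complex.re_ofReal_mul,
    ← ProbabilityTheory.beta_eq_betaIntegralReal b a hb ha] at hbeta
  rw [hshift, hbeta, mul_comm, ProbabilityTheory.beta, ProbabilityTheory.beta,
    mul_comm (Real.Gamma b), add_comm b a]

lemma intervalIntegrable_beta_kernel {a b τ t : ℝ} (ha : 0 < a) (hb : 0 < b) (h : τ < t) :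
    IntervalIntegrable (fun s => (t - s) ^ (a - 1) * (s - τ) ^ (b - 1)) volume τ t := by
  apply intervalIntegral.intervalIntegrable_of_integral_ne_zero
  rw [integral_beta_kernel ha hb h]
  exact (mul_pos (ProbabilityTheory.beta_pos ha hb) (Real.rpow_pos_of_pos (sub_pos.2 h) _)).ne'

/-- The integrand of the double integral `fracInt a (fracInt b f) t`, extended by zero to the
square `(0, t]²` so that Fubini's theorem applies to it. -/
def abelKernel (a b t : ℝ) (f : ℝ → E) (s τ : ℝ) : E :=
  if τ < s then ((t - s) ^ (a - 1) * (s - τ) ^ (b - 1)) • f τ else 0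

lemma integral_abelKernel_right (a b : ℝ) {t s : ℝ} (f : ℝ → E) (hs : s ∈ Ioc 0 t) :
    ∫ τ in Ioc 0 t, abelKernel a b t f s τ
      = (t - s) ^ (a - 1) • ∫ τ in (0 : ℝ)..s, ((s - τ) ^ (b - 1) : ℝ) • f τ := by
  have hker : abelKernel a b t f s = (Iio s).indicator
      fun τ => (t - s) ^ (a - 1) • (s - τ) ^ (b - 1) • f τ := by
    ext τ
    simp [abelKernel, indicator_apply, smul_smul]
  have hset : Ioc 0 t ∩ Iio s = Ioo 0 s := by
    ext τ
    simp only [mem_inter_iff, mem_Ioc, mem_Iio, mem_Ioo]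
    exact ⟨fun h => ⟨h.1.1, h.2⟩, fun h => ⟨⟨h.1, h.2.le.trans hs.2⟩, h.2⟩⟩
  rw [hker, setIntegral_indicator measurableSet_Iio, hset,
    intervalIntegral.integral_of_le hs.1.le, ← integral_smul, integral_Ioc_eq_integral_Ioo]

lemma abelKernel_left_eq_indicator (a b t : ℝ) (f : ℝ → E) (τ : ℝ) :
    (fun s => abelKernel a b t f s τ) = (Ioi τ).indicator
      fun s => ((t - s) ^ (a - 1) * (s - τ) ^ (b - 1)) • f τ := by
  ext s
  simp [abelKernel, indicator_apply]

lemma integrableOn_abelKernel_left {a b : ℝ} (ha : 0 < a) (hb : 0 < b) {t τ : ℝ} (f : ℝ → E)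
    (hτ : τ ∈ Ioo 0 t) : IntegrableOn (fun s => abelKernel a b t f s τ) (Ioc 0 t) := by
  rw [abelKernel_left_eq_indicator, IntegrableOn, integrable_indicator_iff measurableSet_Ioi,
    IntegrableOn, Measure.restrict_restrict measurableSet_Ioi, inter_comm, Ioc_inter_Ioi,
    sup_eq_right.2 hτ.1.le]
  exact ((intervalIntegrable_iff_integrableOn_Ioc_of_le hτ.2.le).1
    (intervalIntegrable_beta_kernel ha hb hτ.2)).smul_const _

lemma integral_abelKernel_left [CompleteSpace E] {a b : ℝ} (ha : 0 < a) (hb : 0 < b) {t τ : ℝ}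
    (f : ℝ → E) (hτ : τ ∈ Ioo 0 t) :
    ∫ s in Ioc 0 t, abelKernel a b t f s τ
      = ProbabilityTheory.beta a b • (t - τ) ^ (a + b - 1) • f τ := by
  rw [abelKernel_left_eq_indicator, setIntegral_indicator measurableSet_Ioi, Ioc_inter_Ioi,
    sup_eq_right.2 hτ.1.le, ← intervalIntegral.integral_of_le hτ.2.le,
    intervalIntegral.integral_smul_const, integral_beta_kernel ha hb hτ.2, smul_smul]

lemma norm_abelKernel (a b : ℝ) {t s : ℝ} (hs : s ≤ t) (f : ℝ → E) (τ : ℝ) :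
    ‖abelKernel a b t f s τ‖ = abelKernel a b t (fun τ => ‖f τ‖) s τ := by
  unfold abelKernel
  split_ifs with h
  · rw [norm_smul, smul_eq_mul, Real.norm_of_nonneg (mul_nonneg
      (Real.rpow_nonneg (sub_nonneg.2 hs) _) (Real.rpow_nonneg (sub_pos.2 h).le _))]
  · exact norm_zero

lemma aestronglyMeasurable_abelKernel (a b t : ℝ) {f : ℝ → E} {μ ν : Measure ℝ}
    (hf : AEStronglyMeasurable f ν) :
    AEStronglyMeasurable (Function.uncurry (abelKernel a b t f)) (μ.prod ν) := by
  have hker : Function.uncurry (abelKernel a b t f) = {p : ℝ × ℝ | p.2 < p.1}.indicator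
      fun p => ((t - p.1) ^ (a - 1) * (p.1 - p.2) ^ (b - 1)) • f p.2 := by
    ext p
    simp [Function.uncurry, abelKernel, indicator_apply]
  rw [hker]
  refine AEStronglyMeasurable.indicator ?_ (measurableSet_lt measurable_snd measurable_fst)
  exact (Measurable.aestronglyMeasurable (by fun_prop)).smul hf.comp_snd

lemma intervalIntegrable_rpow_sub_smul_of_one_le {a t : ℝ} (ha : 1 ≤ a) {f : ℝ → E}
    (hf : IntervalIntegrable f volume 0 t) :
    IntervalIntegrable (fun s => (t - s) ^ (a - 1) • f s) volume 0 t :=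
  hf.continuousOn_smul ((Real.continuous_rpow_const (sub_nonneg.2 ha)).comp
    (continuous_const.sub continuous_id)).continuousOn

lemma integrable_abelKernel {a b : ℝ} (ha : 0 < a) (hb : 0 < b) (hab : 1 ≤ a + b) {t : ℝ}
    (ht : 0 ≤ t) {f : ℝ → E} (hf : IntervalIntegrable f volume 0 t) :
    Integrable (Function.uncurry (abelKernel a b t f))
      ((volume.restrict (Ioc 0 t)).prod (volume.restrict (Ioc 0 t))) := by
  have hIoo : ∀ᵐ τ ∂(volume.restrict (Ioc 0 t)), τ ∈ Ioo 0 t := by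
    rw [← restrict_Ioo_eq_restrict_Ioc]
    exact ae_restrict_mem measurableSet_Ioo
  have hker := (intervalIntegrable_iff_integrableOn_Ioc_of_le ht).1
    (intervalIntegrable_rpow_sub_smul_of_one_le hab hf)
  rw [intervalIntegrable_iff_integrableOn_Ioc_of_le ht] at hf
  rw [integrable_prod_iff' (aestronglyMeasurable_abelKernel a b t hf.aestronglyMeasurable)]
  refine ⟨hIoo.mono fun τ hτ => integrableOn_abelKernel_left ha hb f hτ, ?_⟩
  refine (hker.norm.const_mul (ProbabilityTheory.beta a b)).congr ?_
  filter_upwards [hIoo] with τ hτ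
  have hnorm := integral_abelKernel_left ha hb (fun τ => ‖f τ‖) hτ
  simp only [smul_eq_mul] at hnorm
  rw [norm_smul, Real.norm_of_nonneg (Real.rpow_nonneg (sub_pos.2 hτ.2).le _), ← hnorm]
  exact setIntegral_congr_fun measurableSet_Ioc fun s hs => (norm_abelKernel a b hs.2 f τ).symm

theorem fracInt_fracInt [CompleteSpace E] {a b : ℝ} (ha : 0 ≤ a) (hb : 0 ≤ b) (hab : 1 ≤ a + b)
    {t : ℝ} (ht : 0 ≤ t) {f : ℝ → E} (hf : IntervalIntegrable f volume 0 t) :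
    fracInt a (fracInt b f) t = fracInt (a + b) f t := by
  obtain rfl | ha := ha.eq_or_lt
  · rw [fracInt_zero, zero_add]
  obtain rfl | hb := hb.eq_or_lt
  · rw [fracInt_zero, add_zero]
  have hswap := integral_integral_swap (integrable_abelKernel ha hb hab ht hf)
  have hleft : ∫ s in Ioc 0 t, ∫ τ in Ioc 0 t, abelKernel a b t f s τ
      = ∫ s in Ioc 0 t, (t - s) ^ (a - 1) • ∫ τ in (0 : ℝ)..s, ((s - τ) ^ (b - 1) : ℝ) • f τ :=
    setIntegral_congr_fun measurableSet_Ioc fun s hs => integral_abelKernel_right a b f hs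
  have hright : ∫ τ in Ioc 0 t, ∫ s in Ioc 0 t, abelKernel a b t f s τ
      = ProbabilityTheory.beta a b • ∫ τ in Ioc 0 t, (t - τ) ^ (a + b - 1) • f τ := by
    rw [integral_Ioc_eq_integral_Ioo, integral_Ioc_eq_integral_Ioo (y := t), ← integral_smul]
    exact setIntegral_congr_fun measurableSet_Ioo fun τ hτ => integral_abelKernel_left ha hb f hτ
  rw [hleft, hright] at hswap
  simp_rw [fracInt_of_ne ha.ne', fracInt_of_ne hb.ne', fracInt_of_ne (add_pos ha hb).ne',
    smul_comm _ (Real.Gamma b)⁻¹]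
  rw [intervalIntegral.integral_smul, intervalIntegral.integral_of_le ht, hswap,
    intervalIntegral.integral_of_le ht, smul_smul, smul_smul, ProbabilityTheory.beta]
  congr 1
  have := (Real.Gamma_pos_of_pos ha).ne'
  have := (Real.Gamma_pos_of_pos hb).ne'
  field_simp

lemma intervalIntegrable_fracInt {a : ℝ} (ha : 0 ≤ a) {t : ℝ} (ht : 0 ≤ t) {f : ℝ → E}
    (hf : IntervalIntegrable f volume 0 t) : IntervalIntegrable (fracInt a f) volume 0 t := by
  obtain rfl | ha := ha.eq_or_lt
  · rwa [fracInt_zero]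
  have hint := (integrable_abelKernel one_pos ha (by linarith) ht hf).integral_prod_left
  rw [intervalIntegrable_iff_integrableOn_Ioc_of_le ht]
  refine (hint.smul (Real.Gamma a)⁻¹).congr ?_
  filter_upwards [ae_restrict_mem measurableSet_Ioc] with s hs
  simp only [Function.uncurry_apply_pair, Pi.smul_apply, integral_abelKernel_right 1 a f hs,
    sub_self, Real.rpow_zero, one_smul, fracInt_of_ne ha.ne']

lemma fracInt_eq_rpow_smul_integral {a : ℝ} (ha : 0 < a) (f : ℝ → E) {t : ℝ} (ht : 0 ≤ t) :
    fracInt a f t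
      = (t ^ a / Real.Gamma a) • ∫ r in (0 : ℝ)..1, ((1 - r) ^ (a - 1) : ℝ) • f (t * r) := by
  obtain rfl | ht := ht.eq_or_lt
  · simp [fracInt_of_ne ha.ne', Real.zero_rpow ha.ne']
  have hscale := intervalIntegral.smul_integral_comp_mul_left (a := 0) (b := 1)
    (fun s => (t - s) ^ (a - 1) • f s) t
  rw [mul_zero, mul_one] at hscale
  have hpow : ∫ r in (0 : ℝ)..1, (t - t * r) ^ (a - 1) • f (t * r)
      = t ^ (a - 1) • ∫ r in (0 : ℝ)..1, (1 - r) ^ (a - 1) • f (t * r) := by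
    rw [← intervalIntegral.integral_smul]
    refine intervalIntegral.integral_congr fun r hr => ?_
    rw [uIcc_of_le zero_le_one] at hr
    rw [smul_smul, ← Real.mul_rpow ht.le (sub_nonneg.2 hr.2), mul_sub, mul_one]
  rw [fracInt_of_ne ha.ne', ← hscale, hpow, smul_smul, smul_smul, Real.rpow_sub_one ht.ne']
  congr 1
  field_simp

lemma continuousOn_fracInt {X : Type*} [TopologicalSpace X] [LocallyCompactSpace X]
    [FirstCountableTopology X] {a T : ℝ} (ha : 0 ≤ a) {F : X → ℝ → E}
    (hF : ContinuousOn (fun p : X × ℝ => F p.1 p.2) (univ ×ˢ Icc 0 T)) :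
    ContinuousOn (fun p : X × ℝ => fracInt a (F p.1) p.2) (univ ×ˢ Icc 0 T) := by
  obtain rfl | ha := ha.eq_or_lt
  · simpa only [fracInt_zero] using hF
  refine ContinuousOn.congr ?_ fun p hp => fracInt_eq_rpow_smul_integral ha _ hp.2.1
  refine ContinuousOn.smul
    (((Real.continuous_rpow_const ha.le).comp continuous_snd).div_const _).continuousOn ?_
  rintro ⟨x₀, t₀⟩ hp₀
  obtain ⟨K, hK, hxK⟩ := exists_compact_mem_nhds x₀
  obtain ⟨M, hM⟩ := (hK.prod isCompact_Icc).exists_bound_of_continuousOn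
    (hF.mono (prod_mono_left (subset_univ K)))
  have hmem : ∀ t ∈ Icc 0 T, ∀ r ∈ Icc (0 : ℝ) 1, t * r ∈ Icc 0 T := fun t ht r hr =>
    ⟨mul_nonneg ht.1 hr.1, (mul_le_of_le_one_right ht.1 hr.2).trans ht.2⟩
  have hcont : ∀ p ∈ (univ : Set X) ×ˢ Icc 0 T,
      ContinuousOn (fun r => F p.1 (p.2 * r)) (Icc 0 1) := fun p hp =>
    hF.comp (f := fun r => (p.1, p.2 * r)) (by fun_prop)
      fun r hr => ⟨mem_univ _, hmem _ hp.2 r hr⟩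
  have hweight := intervalIntegrable_rpow_sub ha 0 1
  refine intervalIntegral.continuousWithinAt_of_dominated_interval
    (bound := fun r => (1 - r) ^ (a - 1) * M) ?_ ?_ (hweight.mul_const M) ?_
  · filter_upwards [self_mem_nhdsWithin] with p hp
    exact ((hweight.smul_continuousOn (uIcc_of_le (zero_le_one' ℝ) ▸ hcont p hp)).def'
      ).aestronglyMeasurable
  · filter_upwards [self_mem_nhdsWithin,
      mem_nhdsWithin_of_mem_nhds (prod_mem_nhds hxK univ_mem)] with p hp hpK
    refine Eventually.of_forall fun r hr => ?_
    rw [uIoc_of_le zero_le_one] at hr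
    have hw : 0 ≤ (1 - r) ^ (a - 1) := Real.rpow_nonneg (sub_nonneg.2 hr.2) _
    rw [norm_smul, Real.norm_of_nonneg hw]
    gcongr
    exact hM (p.1, p.2 * r) ⟨hpK.1, hmem _ hp.2 r (Ioc_subset_Icc_self hr)⟩
  · refine Eventually.of_forall fun r hr => ?_
    rw [uIoc_of_le zero_le_one] at hr
    have hmaps : MapsTo (fun p : X × ℝ => (p.1, p.2 * r)) (univ ×ˢ Icc 0 T) (univ ×ˢ Icc 0 T) :=
      fun p hp => ⟨mem_univ _, hmem _ hp.2 r (Ioc_subset_Icc_self hr)⟩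
    exact ((hF.comp (f := fun p : X × ℝ => (p.1, p.2 * r)) (by fun_prop) hmaps)
      (x₀, t₀) hp₀).const_smul _

lemma continuousOn_fracInt_of_continuousOn {a T : ℝ} (ha : 0 ≤ a) {f : ℝ → E}
    (hf : ContinuousOn f (Icc 0 T)) : ContinuousOn (fracInt a f) (Icc 0 T) :=
  (continuousOn_fracInt (X := Unit) (F := fun _ => f) ha
    (hf.comp continuousOn_snd fun _ hp => hp.2)).comp (f := fun t => ((), t)) (by fun_prop)
    fun _ ht => ⟨mem_univ _, ht⟩

end FractionalIntegral

/-! ### Volterra equations with an Abel kernel -/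

section Real

lemma fracInt_pos {a t : ℝ} (ha : 0 < a) (ht : 0 < t) {f : ℝ → ℝ} (hf : ContinuousOn f (Icc 0 t))
    (hpos : ∀ s ∈ Ioo 0 t, 0 < f s) : 0 < fracInt a f t := by
  rw [fracInt_of_ne ha.ne']
  refine mul_pos (inv_pos.2 (Real.Gamma_pos_of_pos ha)) ?_
  refine intervalIntegral.intervalIntegral_pos_of_pos_on
    (intervalIntegrable_rpow_sub_smul ha ht.le hf) (fun s hs => ?_) ht
  exact mul_pos (Real.rpow_pos_of_pos (sub_pos.2 hs.2) _) (hpos s hs)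

lemma integral_rpow_sub_mul_le {a b c M : ℝ} (ha : 0 < a) (hc : c ∈ Icc 0 b)
    {f : ℝ → ℝ} (hf : ContinuousOn f (Icc 0 b)) (hM : ∀ s ∈ Icc c b, f s ≤ M) :
    ∫ s in c..b, (b - s) ^ (a - 1) * f s ≤ (b - c) ^ a / a * M := by
  have hsub : uIcc c b ⊆ Icc 0 b := by rw [uIcc_of_le hc.2]; exact Icc_subset_Icc_left hc.1
  rw [← integral_rpow_sub ha, ← intervalIntegral.integral_mul_const]
  refine intervalIntegral.integral_mono_on hc.2
    ((intervalIntegrable_rpow_sub ha c b).mul_continuousOn (hf.mono hsub))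
    ((intervalIntegrable_rpow_sub ha c b).mul_const M) fun s hs => ?_
  exact mul_le_mul_of_nonneg_left (hM s hs) (Real.rpow_nonneg (sub_nonneg.2 hs.2) _)

/-- Only the values of `f` on `[a, b]` contribute to an upper bound for the increment, because the
kernel decreases as the end point of integration moves to the right. -/
lemma fracInt_sub_fracInt_le {ρ a b M : ℝ} (hρ : 0 < ρ) (hρ' : ρ ≤ 1) (ha : 0 ≤ a) (hab : a ≤ b)
    {f : ℝ → ℝ} (hf : ContinuousOn f (Icc 0 b)) (hnonneg : ∀ s ∈ Icc 0 a, 0 ≤ f s)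
    (hM : ∀ s ∈ Icc a b, f s ≤ M) :
    fracInt ρ f b - fracInt ρ f a ≤ (b - a) ^ ρ / Real.Gamma (ρ + 1) * M := by
  have hfa : ContinuousOn f (Icc 0 a) := hf.mono (Icc_subset_Icc_right hab)
  have hint (c d : ℝ) (hc : 0 ≤ c) (hcd : c ≤ d) (hd : d ≤ b) :
      IntervalIntegrable (fun s => (b - s) ^ (ρ - 1) * f s) volume c d :=
    ((intervalIntegrable_rpow_sub_smul hρ (ha.trans hab) hf).mono_set (by
      rw [uIcc_of_le hcd, uIcc_of_le (ha.trans hab)]; exact Icc_subset_Icc hc hd))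
  have hold : ∫ s in (0 : ℝ)..a, (b - s) ^ (ρ - 1) * f s
      ≤ ∫ s in (0 : ℝ)..a, (a - s) ^ (ρ - 1) * f s := by
    refine intervalIntegral.integral_mono_on_of_le_Ioo ha (hint 0 a le_rfl ha hab)
      (intervalIntegrable_rpow_sub_smul hρ ha hfa) fun s hs => ?_
    exact mul_le_mul_of_nonneg_right (Real.rpow_le_rpow_of_nonpos (sub_pos.2 hs.2) (by linarith)
      (by linarith)) (hnonneg s (Ioo_subset_Icc_self hs))
  have hnew := integral_rpow_sub_mul_le hρ ⟨ha, hab⟩ hf hM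
  simp only [fracInt_of_ne hρ.ne', smul_eq_mul]
  rw [← intervalIntegral.integral_add_adjacent_intervals (hint 0 a le_rfl ha hab)
    (hint a b ha hab le_rfl), ← mul_sub, Real.Gamma_add_one hρ.ne']
  calc (Real.Gamma ρ)⁻¹ * _ ≤ (Real.Gamma ρ)⁻¹ * ((b - a) ^ ρ / ρ * M) := by
        gcongr
        linarith
    _ = (b - a) ^ ρ / (ρ * Real.Gamma ρ) * M := by
        have := (Real.Gamma_pos_of_pos hρ).ne'
        field_simp

lemma exists_pos_mul_rpow_div_Gamma_lt_one {ρ : ℝ} (hρ : 0 < ρ) (K : ℝ) :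
    ∃ δ > 0, K * (δ ^ ρ / Real.Gamma (ρ + 1)) < 1 := by
  have hlim : Tendsto (fun δ : ℝ => K * (δ ^ ρ / Real.Gamma (ρ + 1))) (𝓝[>] 0) (𝓝 0) := by
    have : ContinuousAt (fun δ : ℝ => K * (δ ^ ρ / Real.Gamma (ρ + 1))) 0 :=
      continuousAt_const.mul ((Real.continuousAt_rpow_const 0 ρ (Or.inr hρ.le)).div_const _)
    simpa [Real.zero_rpow hρ.ne'] using this.tendsto.mono_left nhdsWithin_le_nhds
  obtain ⟨δ, hδ, hlt⟩ := (eventually_mem_nhdsWithin.and (hlim.eventually_lt_const one_pos)).exists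
  exact ⟨δ, hδ, hlt⟩

/-- At a first zero `t₁` of `g`, the drop of `g` from its maximum on a short interval ending at
`t₁` would be smaller than the maximum itself. -/
lemma pos_of_eq_sub_fracInt_of_pos_before {ρ c lam t₁ : ℝ} (hρ : 0 < ρ) (hρ' : ρ ≤ 1) (hc : 0 < c)
    (ht₁ : 0 < t₁) {g : ℝ → ℝ} (hg : ContinuousOn g (Icc 0 t₁))
    (h : ∀ t ∈ Icc 0 t₁, g t = c - lam * fracInt ρ g t) (hpos : ∀ s ∈ Ico 0 t₁, 0 < g s) :
    0 < g t₁ := by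
  have hmem₁ : t₁ ∈ Icc 0 t₁ := ⟨ht₁.le, le_rfl⟩
  rcases le_or_gt lam 0 with hlam | hlam
  · have hint := fracInt_pos hρ ht₁ hg fun s hs => hpos s (Ioo_subset_Ico_self hs)
    rw [h t₁ hmem₁]
    nlinarith
  by_contra! hneg
  obtain ⟨δ, hδ, hδ1⟩ := exists_pos_mul_rpow_div_Gamma_lt_one hρ lam
  set t₀ := max 0 (t₁ - δ)
  have ht₀ : t₀ < t₁ := max_lt ht₁ (by linarith)
  have ht₀' : 0 ≤ t₀ := le_max_left _ _
  obtain ⟨t, ht, hmax⟩ := isCompact_Icc.exists_isMaxOn ⟨t₀, le_rfl, ht₀.le⟩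
    (hg.mono (Icc_subset_Icc_left ht₀'))
  have hgt : 0 < g t := (hpos t₀ ⟨ht₀', ht₀⟩).trans_le (hmax ⟨le_rfl, ht₀.le⟩)
  have htt₁ : t < t₁ := lt_of_le_of_ne ht.2 fun he => (he ▸ hgt).not_ge hneg
  have ht0 : 0 ≤ t := ht₀'.trans ht.1
  have hdrop := fracInt_sub_fracInt_le hρ hρ' ht0 ht.2 hg
    (fun s hs => (hpos s ⟨hs.1, hs.2.trans_lt htt₁⟩).le) fun s hs => hmax ⟨ht.1.trans hs.1, hs.2⟩
  have hlen : (t₁ - t) ^ ρ ≤ δ ^ ρ :=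
    Real.rpow_le_rpow (by linarith) (by linarith [le_max_right 0 (t₁ - δ), ht.1]) hρ.le
  have : 0 < Real.Gamma (ρ + 1) := Real.Gamma_pos_of_pos (by linarith)
  have : g t < g t := calc
    g t ≤ g t - g t₁ := by linarith
    _ = lam * (fracInt ρ g t₁ - fracInt ρ g t) := by
        rw [h t ⟨ht0, ht.2⟩, h t₁ hmem₁]; ring
    _ ≤ lam * ((t₁ - t) ^ ρ / Real.Gamma (ρ + 1) * g t) := by gcongr
    _ ≤ lam * (δ ^ ρ / Real.Gamma (ρ + 1) * g t) := by gcongr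
    _ = lam * (δ ^ ρ / Real.Gamma (ρ + 1)) * g t := by ring
    _ < g t := mul_lt_of_lt_one_left hgt hδ1
  exact this.false

theorem pos_of_eq_sub_fracInt {ρ T c lam : ℝ} (hρ : 0 < ρ) (hρ' : ρ ≤ 1) (hc : 0 < c)
    {g : ℝ → ℝ} (hg : ContinuousOn g (Icc 0 T))
    (h : ∀ t ∈ Icc 0 T, g t = c - lam * fracInt ρ g t) : ∀ t ∈ Icc 0 T, 0 < g t := by
  by_contra! hneg
  have hcompact : IsCompact (Icc 0 T ∩ g ⁻¹' Iic 0) :=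
    isCompact_Icc.of_isClosed_subset (hg.preimage_isClosed_of_isClosed isClosed_Icc isClosed_Iic)
      inter_subset_left
  obtain ⟨t₁, ⟨ht₁, hgt₁⟩, hleast⟩ := hcompact.exists_isLeast hneg
  have ht₁0 : t₁ ≠ 0 := by
    rintro rfl
    have hg0 : g 0 = c := by simp [h 0 ht₁, fracInt_of_ne hρ.ne']
    exact hc.not_ge (hg0 ▸ hgt₁)
  refine (pos_of_eq_sub_fracInt_of_pos_before hρ hρ' hc (ht₁.1.lt_of_ne' ht₁0)
    (hg.mono (Icc_subset_Icc_right ht₁.2)) (fun t ht => h t ⟨ht.1, ht.2.trans ht₁.2⟩)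
    fun s hs => ?_).not_ge hgt₁
  by_contra! hs'
  exact hs.2.not_ge (hleast ⟨⟨hs.1, hs.2.le.trans ht₁.2⟩, hs'⟩)

lemma fracInt_exp_le {a κ t : ℝ} (ha : 0 < a) (hκ : 0 < κ) (ht : 0 ≤ t) :
    fracInt a (fun s => Real.exp (κ * s)) t ≤ κ ^ (-a) * Real.exp (κ * t) := by
  have := Real.Gamma_pos_of_pos ha
  have hIoi := Real.integral_rpow_mul_exp_neg_mul_Ioi ha hκ
  have hintegrable : IntegrableOn (fun r => r ^ (a - 1) * Real.exp (-(κ * r))) (Ioi 0) :=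
    not_imp_comm.1 integral_undef (by rw [hIoi]; positivity)
  have hreflect : ∫ s in (0 : ℝ)..t, (t - s) ^ (a - 1) * Real.exp (κ * s)
      = (∫ r in (0 : ℝ)..t, r ^ (a - 1) * Real.exp (-(κ * r))) * Real.exp (κ * t) := by
    have hsub := intervalIntegral.integral_comp_sub_left (a := 0) (b := t)
      (fun r => r ^ (a - 1) * Real.exp (κ * (t - r))) t
    simp only [sub_sub_cancel, sub_self, sub_zero] at hsub
    rw [hsub, ← intervalIntegral.integral_mul_const]
    refine intervalIntegral.integral_congr fun r _ => ?_
    rw [mul_assoc, ← Real.exp_add]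
    ring_nf
  have htail : ∫ r in (0 : ℝ)..t, r ^ (a - 1) * Real.exp (-(κ * r))
      ≤ (1 / κ) ^ a * Real.Gamma a := by
    rw [← hIoi, intervalIntegral.integral_of_le ht]
    refine setIntegral_mono_set hintegrable ?_ Ioc_subset_Ioi_self.eventuallyLE
    filter_upwards [ae_restrict_mem measurableSet_Ioi] with r (hr : 0 < r)
    simp only [Pi.zero_apply]
    positivity
  rw [fracInt_of_ne ha.ne']
  simp only [smul_eq_mul]
  rw [hreflect]
  calc _ ≤ (Real.Gamma a)⁻¹ * ((1 / κ) ^ a * Real.Gamma a * Real.exp (κ * t)) := by gcongr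
    _ = κ ^ (-a) * Real.exp (κ * t) := by
        rw [one_div, Real.inv_rpow hκ.le, ← Real.rpow_neg hκ.le]
        field_simp

end Real

section Volterra

variable {E : Type*} [NormedAddCommGroup E] [NormedSpace ℝ E]

lemma fracInt_const_smul (a c : ℝ) (f : ℝ → E) (t : ℝ) :
    fracInt a (fun s => c • f s) t = c • fracInt a f t := by
  unfold fracInt
  split_ifs
  · rfl
  · simp_rw [smul_comm _ c]
    rw [intervalIntegral.integral_smul, smul_comm]

lemma norm_fracInt_le_of_norm_le {a t : ℝ} (ha : 0 < a) (ht : 0 ≤ t) {f : ℝ → E} {B : ℝ → ℝ}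
    (hB : ContinuousOn B (Icc 0 t)) (h : ∀ s ∈ Icc 0 t, ‖f s‖ ≤ B s) :
    ‖fracInt a f t‖ ≤ fracInt a B t := by
  have hΓ := inv_pos.2 (Real.Gamma_pos_of_pos ha)
  rw [fracInt_of_ne ha.ne', fracInt_of_ne ha.ne', norm_smul, Real.norm_of_nonneg hΓ.le, smul_eq_mul]
  gcongr
  refine intervalIntegral.norm_integral_le_of_norm_le ht (Eventually.of_forall fun s hs => ?_)
    (intervalIntegrable_rpow_sub_smul ha ht hB)
  have hw : 0 ≤ (t - s) ^ (a - 1) := Real.rpow_nonneg (sub_nonneg.2 hs.2) _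
  rw [norm_smul, Real.norm_of_nonneg hw, smul_eq_mul]
  exact mul_le_mul_of_nonneg_left (h s (Ioc_subset_Icc_self hs)) hw

/-- In the weighted norm `sup_t ‖y t‖ e^{-κ t}` with `κ` large, `lam • fracInt ρ` is a
contraction. -/
lemma eqOn_zero_of_eq_smul_fracInt {ρ T lam : ℝ} (hρ : 0 < ρ) {y : ℝ → E}
    (hy : ContinuousOn y (Icc 0 T)) (h : ∀ t ∈ Icc 0 T, y t = lam • fracInt ρ y t) :
    EqOn y 0 (Icc 0 T) := by
  intro t ht
  have hlim : Tendsto (fun κ : ℝ => ‖lam‖ * κ ^ (-ρ)) atTop (𝓝 0) := by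
    simpa using (tendsto_rpow_neg_atTop hρ).const_mul ‖lam‖
  obtain ⟨κ, hκ, hcontr⟩ :=
    ((eventually_gt_atTop 0).and (hlim.eventually_lt_const one_pos)).exists
  obtain ⟨t₀, ht₀, hmax⟩ := isCompact_Icc.exists_isMaxOn ⟨t, ht⟩
    (hy.norm.mul (f := fun s => ‖y s‖) (g := fun s => Real.exp (-(κ * s))) (by fun_prop))
  set M := ‖y t₀‖ * Real.exp (-(κ * t₀)) with hM
  have hbound : ∀ s ∈ Icc 0 T, ‖y s‖ ≤ M • Real.exp (κ * s) := fun s hs => by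
    rw [smul_eq_mul, ← div_le_iff₀ (Real.exp_pos _), div_eq_mul_inv, ← Real.exp_neg]
    exact hmax hs
  have hfix : M ≤ ‖lam‖ * κ ^ (-ρ) * M := calc
    M = ‖lam‖ * ‖fracInt ρ y t₀‖ * Real.exp (-(κ * t₀)) := by
      rw [hM, ← norm_smul, ← h t₀ ht₀]
    _ ≤ ‖lam‖ * (M * (κ ^ (-ρ) * Real.exp (κ * t₀))) * Real.exp (-(κ * t₀)) := by
      gcongr
      refine (norm_fracInt_le_of_norm_le hρ ht₀.1 (by fun_prop)
        fun s hs => hbound s ⟨hs.1, hs.2.trans ht₀.2⟩).trans ?_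
      rw [fracInt_const_smul, smul_eq_mul]
      exact mul_le_mul_of_nonneg_left (fracInt_exp_le hρ hκ ht₀.1) (by positivity)
    _ = ‖lam‖ * κ ^ (-ρ) * M := by
      rw [Real.exp_neg]
      field_simp
  have hM0 : M ≤ 0 := by
    by_contra! hpos
    nlinarith
  exact norm_le_zero_iff.1
    ((hbound t ht).trans (mul_nonpos_of_nonpos_of_nonneg hM0 (Real.exp_pos _).le))

/-- If `c ≠ 0`, a functional `L` with `L c > 0` turns the equation into one for
`g = L (c - lam • y)`, which is positive; hence `L (y T) = fracInt ρ g T > 0`. -/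
theorem eq_zero_of_eq_fracInt_of_endpoint [CompleteSpace E] {ρ T lam : ℝ} (hρ : 0 < ρ)
    (hρ' : ρ ≤ 1) (hT : 0 < T) {y : ℝ → E} (hy : ContinuousOn y (Icc 0 T)) {c : E}
    (h : ∀ t ∈ Icc 0 T, y t = fracInt ρ (fun s => c - lam • y s) t) (hyT : y T = 0) : c = 0 := by
  by_contra hc
  obtain ⟨L, -, hLc⟩ := exists_dual_vector ℝ c (norm_ne_zero_iff.2 hc)
  set g : ℝ → ℝ := fun t => L (c - lam • y t)
  have hg : ContinuousOn g (Icc 0 T) := by fun_prop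
  have hL : ∀ t ∈ Icc 0 T, L (y t) = fracInt ρ g t := fun t ht => by
    rw [h t ht, map_fracInt L hρ.le ht.1 (by
      have := hy.mono (Icc_subset_Icc_right ht.2); fun_prop)]
  have hpos : ∀ t ∈ Icc 0 T, 0 < g t := by
    refine pos_of_eq_sub_fracInt (lam := lam) hρ hρ' (norm_pos_iff.2 hc) hg fun t ht => ?_
    rw [← hL t ht]
    simp only [g, map_sub, map_smul, hLc, smul_eq_mul, RCLike.ofReal_real_eq_id, id]
  have hend := fracInt_pos hρ hT hg fun s hs => hpos s (Ioo_subset_Icc_self hs)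
  rw [← hL T ⟨hT.le, le_rfl⟩, hyT, map_zero] at hend
  exact hend.false

theorem eqOn_zero_of_eq_fracInt_of_endpoint [CompleteSpace E] {ρ T lam : ℝ} (hρ : 0 < ρ)
    (hρ' : ρ ≤ 1) (hT : 0 < T) {y : ℝ → E} (hy : ContinuousOn y (Icc 0 T)) {c : E}
    (h : ∀ t ∈ Icc 0 T, y t = fracInt ρ (fun s => c - lam • y s) t) (hyT : y T = 0) :
    EqOn y 0 (Icc 0 T) := by
  obtain rfl : c = 0 := eq_zero_of_eq_fracInt_of_endpoint hρ hρ' hT hy h hyT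
  refine eqOn_zero_of_eq_smul_fracInt (lam := -lam) hρ hy fun t ht => ?_
  rw [h t ht, ← fracInt_const_smul]
  simp only [zero_sub, neg_smul]

lemma eqOn_Icc_of_integral_eq [CompleteSpace E] {T : ℝ} (hT : 0 < T) {f g : ℝ → E}
    (hf : ContinuousOn f (Icc 0 T)) (hg : ContinuousOn g (Icc 0 T))
    (h : ∀ t ∈ Icc 0 T, ∫ s in (0 : ℝ)..t, f s = ∫ s in (0 : ℝ)..t, g s) :
    EqOn f g (Icc 0 T) := by
  have hderiv {k : ℝ → E} (hk : ContinuousOn k (Icc 0 T)) {t : ℝ} (ht : t ∈ Ioo 0 T) :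
      HasDerivAt (fun t => ∫ s in (0 : ℝ)..t, k s) (k t) t := by
    have hnhds := Icc_mem_nhds ht.1 ht.2
    refine intervalIntegral.integral_hasDerivAt_right ?_
      (hk.stronglyMeasurableAtFilter_nhdsWithin measurableSet_Icc t |>.filter_mono
        (nhdsWithin_eq_nhds.2 hnhds).ge) (hk.continuousAt hnhds)
    refine (hk.mono ?_).intervalIntegrable
    rw [uIcc_of_le ht.1.le]
    exact Icc_subset_Icc_right ht.2.le
  have hIoo : EqOn f g (Ioo 0 T) := fun t ht =>
    (hderiv hf ht).unique ((hderiv hg ht).congr_of_eventuallyEq (by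
      filter_upwards [Icc_mem_nhds ht.1 ht.2] with s hs using h s hs))
  exact hIoo.of_subset_closure hf hg Ioo_subset_Icc_self (closure_Ioo hT.ne).ge

theorem eqOn_fracInt_of_fracInt_eq_integral [CompleteSpace E] {ρ T : ℝ} (hρ : 0 ≤ ρ)
    (hρ' : ρ ≤ 1) (hT : 0 < T) {w f : ℝ → E} (hw : ContinuousOn w (Icc 0 T))
    (hf : ContinuousOn f (Icc 0 T))
    (h : ∀ t ∈ Icc 0 T, fracInt (1 - ρ) w t = ∫ s in (0 : ℝ)..t, f s) :
    EqOn w (fracInt ρ f) (Icc 0 T) := by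
  refine eqOn_Icc_of_integral_eq hT hw (continuousOn_fracInt_of_continuousOn hρ hf) fun t ht => ?_
  have hintervalIntegrable {k : ℝ → E} (hk : ContinuousOn k (Icc 0 T)) :
      IntervalIntegrable k volume 0 t :=
    (hk.mono (by rw [uIcc_of_le ht.1]; exact Icc_subset_Icc_right ht.2)).intervalIntegrable
  calc ∫ s in (0 : ℝ)..t, w s
      = fracInt ρ (fracInt (1 - ρ) w) t := by
        rw [fracInt_fracInt hρ (sub_nonneg.2 hρ') (by linarith) ht.1 (hintervalIntegrable hw),
          add_sub_cancel, fracInt_one]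
    _ = fracInt ρ (fracInt 1 f) t := fracInt_congr ht.1 fun s hs => by
        rw [h s ⟨hs.1, hs.2.trans ht.2⟩, fracInt_one]
    _ = fracInt 1 (fracInt ρ f) t := by
        rw [fracInt_fracInt hρ zero_le_one (by linarith) ht.1 (hintervalIntegrable hf),
          fracInt_fracInt zero_le_one hρ (by linarith) ht.1 (hintervalIntegrable hf), add_comm]
    _ = ∫ s in (0 : ℝ)..t, fracInt ρ f s := by rw [fracInt_one]

end Volterra

/-! ### The Caputo derivative -/

section Caputo

lemma absolutelyContinuousOnInterval_comp_lipschitz {X Y : Type*} [PseudoMetricSpace X]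
    [PseudoMetricSpace Y] {K : NNReal} {L : X → Y} (hL : LipschitzWith K L) {g : ℝ → X} {a b : ℝ}
    (hg : AbsolutelyContinuousOnInterval g a b) :
    AbsolutelyContinuousOnInterval (fun s => L (g s)) a b := by
  have hK := Tendsto.const_mul (K : ℝ) hg
  rw [mul_zero] at hK
  refine squeeze_zero (fun E => Finset.sum_nonneg fun i _ => dist_nonneg) (fun E => ?_) hK
  rw [Finset.mul_sum]
  exact Finset.sum_le_sum fun i _ => hL.dist_le_mul _ _

section AbsolutelyContinuous

variable {g : ℝ → ℂ} {a b : ℝ}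

lemma absolutelyContinuousOnInterval_re (hg : AbsolutelyContinuousOnInterval g a b) :
    AbsolutelyContinuousOnInterval (fun s => (g s).re) a b :=
  absolutelyContinuousOnInterval_comp_lipschitz Complex.reCLM.lipschitz hg

lemma absolutelyContinuousOnInterval_im (hg : AbsolutelyContinuousOnInterval g a b) :
    AbsolutelyContinuousOnInterval (fun s => (g s).im) a b :=
  absolutelyContinuousOnInterval_comp_lipschitz Complex.imCLM.lipschitz hg

lemma ae_deriv_eq_re_add_im (hg : AbsolutelyContinuousOnInterval g a b) :
    ∀ᵐ s, s ∈ uIoc a b → deriv g s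
      = ↑(deriv (fun s => (g s).re) s) + ↑(deriv (fun s => (g s).im) s) * Complex.I := by
  filter_upwards [(absolutelyContinuousOnInterval_re hg).ae_differentiableAt,
    (absolutelyContinuousOnInterval_im hg).ae_differentiableAt] with s hre him hs
  have hs' := uIoc_subset_uIcc hs
  have hderiv := (hre hs').hasDerivAt.ofReal_comp.add
    ((him hs').hasDerivAt.ofReal_comp.mul_const Complex.I)
  exact (hderiv.congr_of_eventuallyEq (.of_forall fun r => (Complex.re_add_im (g r)).symm)).deriv

lemma intervalIntegrable_ofReal {f : ℝ → ℝ} (hf : IntervalIntegrable f volume a b) :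
    IntervalIntegrable (fun s => (f s : ℂ)) volume a b :=
  ⟨hf.1.ofReal, hf.2.ofReal⟩

lemma intervalIntegrable_deriv (hg : AbsolutelyContinuousOnInterval g a b) :
    IntervalIntegrable (deriv g) volume a b := by
  have hre := intervalIntegrable_ofReal
    (absolutelyContinuousOnInterval_re hg).intervalIntegrable_deriv
  have him := intervalIntegrable_ofReal
    (absolutelyContinuousOnInterval_im hg).intervalIntegrable_deriv
  refine (hre.add (him.mul_const Complex.I)).congr_ae ?_
  rw [EventuallyEq, ae_restrict_iff' measurableSet_uIoc]
  filter_upwards [ae_deriv_eq_re_add_im hg] with s hs hs' using (hs hs').symm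

theorem integral_deriv_eq_sub (hg : AbsolutelyContinuousOnInterval g a b) :
    ∫ s in a..b, deriv g s = g b - g a := by
  have hre := absolutelyContinuousOnInterval_re hg
  have him := absolutelyContinuousOnInterval_im hg
  rw [intervalIntegral.integral_congr_ae (ae_deriv_eq_re_add_im hg),
    intervalIntegral.integral_add (intervalIntegrable_ofReal hre.intervalIntegrable_deriv)
      ((intervalIntegrable_ofReal him.intervalIntegrable_deriv).mul_const _),
    intervalIntegral.integral_mul_const, intervalIntegral.integral_ofReal,
    intervalIntegral.integral_ofReal, hre.integral_deriv_eq_sub, him.integral_deriv_eq_sub]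
  apply Complex.ext <;> simp

end AbsolutelyContinuous

lemma caputoDeriv_eq_fracInt {ρ : ℝ} (hρ : ρ ≠ 1) (T : ℝ) (g : ℝ → ℂ) :
    caputoDeriv ρ T g = fracInt (1 - ρ) (deriv g) := by
  ext t
  rw [caputoDeriv, if_neg hρ, fracInt_of_ne (sub_ne_zero.2 hρ.symm), one_div, Complex.real_smul,
    sub_sub_cancel_left]

lemma hasDerivWithinAt_caputoDeriv_one {T t : ℝ} {g : ℝ → ℂ}
    (hg : CaputoDifferentiableAt 1 T g t) :
    HasDerivWithinAt g (caputoDeriv 1 T g t) (Icc 0 T) t := by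
  rw [CaputoDifferentiableAt, if_pos rfl] at hg
  rw [caputoDeriv, if_pos rfl]
  exact hg.hasDerivWithinAt

lemma intervalIntegrable_caputoDeriv {ρ T t : ℝ} (hρ : ρ < 1) (ht : 0 ≤ t) {g : ℝ → ℂ}
    (hg : AbsolutelyContinuousOnInterval g 0 t) :
    IntervalIntegrable (caputoDeriv ρ T g) volume 0 t := by
  rw [caputoDeriv_eq_fracInt hρ.ne]
  exact intervalIntegrable_fracInt (by linarith) ht (intervalIntegrable_deriv hg)

lemma integral_caputoDeriv {ρ T t : ℝ} (hρ : ρ < 1) (ht : 0 ≤ t) {g : ℝ → ℂ}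
    (hg : AbsolutelyContinuousOnInterval g 0 t) :
    ∫ s in (0 : ℝ)..t, caputoDeriv ρ T g s = fracInt (1 - ρ) (fun s => g s - g 0) t := by
  have hint := intervalIntegrable_deriv hg
  calc ∫ s in (0 : ℝ)..t, caputoDeriv ρ T g s
      = fracInt 1 (fracInt (1 - ρ) (deriv g)) t := by
        rw [fracInt_one, caputoDeriv_eq_fracInt hρ.ne]
    _ = fracInt (1 - ρ) (fracInt 1 (deriv g)) t := by
        rw [fracInt_fracInt zero_le_one (by linarith) (by linarith) ht hint, add_comm,
          fracInt_fracInt (by linarith) zero_le_one (by linarith) ht hint]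
    _ = fracInt (1 - ρ) (fun s => g s - g 0) t := fracInt_congr ht fun s hs => by
        rw [fracInt_one]
        refine integral_deriv_eq_sub (hg.mono ?_)
        rw [uIcc_of_le hs.1, uIcc_of_le ht]
        exact Icc_subset_Icc_right hs.2

theorem integral_caputoDeriv_eq_sub {ρ T ε t : ℝ} (hρ : ρ ≤ 1) (hε : 0 < ε) (hεt : ε ≤ t)
    (htT : t ≤ T) {g : ℝ → ℂ} (hg : ∀ s ∈ Ioc 0 T, CaputoDifferentiableAt ρ T g s)
    (hcont : ContinuousOn (caputoDeriv ρ T g) (Ioc 0 T)) :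
    ∫ s in ε..t, caputoDeriv ρ T g s
      = fracInt (1 - ρ) (fun s => g s - g 0) t - fracInt (1 - ρ) (fun s => g s - g 0) ε := by
  have hsub : Icc ε t ⊆ Ioc 0 T := fun s hs => ⟨hε.trans_le hs.1, hs.2.trans htT⟩
  obtain rfl | hρ := hρ.eq_or_lt
  · have hderiv : ∀ s ∈ Icc ε t, HasDerivWithinAt g (caputoDeriv 1 T g s) (Icc 0 T) s :=
      fun s hs => hasDerivWithinAt_caputoDeriv_one (hg s (hsub hs))
    rw [intervalIntegral.integral_eq_sub_of_hasDerivAt_of_le hεt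
      (fun s hs => (hderiv s hs).continuousWithinAt.mono fun r hr => Ioc_subset_Icc_self (hsub hr))
      (fun s hs => (hderiv s (Ioo_subset_Icc_self hs)).hasDerivAt
        (Icc_mem_nhds (hε.trans hs.1) (hs.2.trans_le htT)))
      (hcont.mono (by rwa [uIcc_of_le hεt])).intervalIntegrable]
    simp only [sub_self, fracInt_zero, sub_sub_sub_cancel_right]
  · have hac : ∀ s ∈ Icc ε t, AbsolutelyContinuousOnInterval g 0 s := fun s hs => by
      have := hg s (hsub hs)
      rw [CaputoDifferentiableAt, if_neg hρ.ne] at this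
      exact this.1
    have hact := hac t ⟨hεt, le_rfl⟩
    have hacε := hac ε ⟨le_rfl, hεt⟩
    have ht := hε.le.trans hεt
    rw [← integral_caputoDeriv hρ ht hact, ← integral_caputoDeriv hρ hε.le hacε,
      intervalIntegral.integral_interval_sub_left (intervalIntegrable_caputoDeriv hρ ht hact)
        (intervalIntegrable_caputoDeriv hρ hε.le hacε)]

end Caputo

/-! ### Fourier coefficients on the torus -/

section Torus

variable {N : ℕ}

lemma cell_ae_eq_Icc (N : ℕ) :
    (cell N : Set (Fin N → ℝ)) =ᵐ[volume] Icc (fun _ => -Real.pi) fun _ => Real.pi := by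
  rw [volume_pi]
  exact Measure.univ_pi_Ioc_ae_eq_Icc

lemma cell_subset_Icc (N : ℕ) : cell N ⊆ Icc (fun _ => -Real.pi) fun _ => Real.pi :=
  fun _ hx => ⟨fun i => (hx i trivial).1.le, fun i => (hx i trivial).2⟩

lemma measurableSet_cell (N : ℕ) : MeasurableSet (cell N) :=
  MeasurableSet.univ_pi fun _ => measurableSet_Ioc

lemma integrableOn_cell {g : (Fin N → ℝ) → ℂ} (hg : Continuous g) : IntegrableOn g (cell N) :=
  (hg.continuousOn.integrableOn_compact isCompact_Icc).mono_set (cell_subset_Icc N)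

lemma continuous_mul_conj {X : Type*} [TopologicalSpace X] {g h : X → ℂ}
    (hg : Continuous g) (hh : Continuous h) : Continuous fun x => g x * starRingEnd ℂ (h x) :=
  hg.mul (Complex.continuous_conj.comp hh)

lemma torusInner_sub {g₁ g₂ h : (Fin N → ℝ) → ℂ} (hg₁ : Continuous g₁) (hg₂ : Continuous g₂)
    (hh : Continuous h) :
    torusInner (fun x => g₁ x - g₂ x) h = torusInner g₁ h - torusInner g₂ h := by
  simp only [torusInner, sub_mul]
  exact integral_sub (integrableOn_cell (continuous_mul_conj hg₁ hh))
    (integrableOn_cell (continuous_mul_conj hg₂ hh))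

lemma conj_torusInner (g h : (Fin N → ℝ) → ℂ) :
    starRingEnd ℂ (torusInner g h) = torusInner h g := by
  simp only [torusInner, ← integral_conj, map_mul, Complex.conj_conj, mul_comm]

lemma insertNth_add_eq_add_single {n : ℕ} (i : Fin (n + 1)) (r s : ℝ) (x : Fin n → ℝ) :
    (i.insertNth (r + s) x : Fin (n + 1) → ℝ) = i.insertNth r x + Pi.single i s := by
  ext k
  refine Fin.succAboveCases i ?_ (fun k => ?_) k <;> simp

lemma integral_lineDeriv_eq_zero {h : (Fin N → ℝ) → ℂ} (hh : ContDiff ℝ 1 h)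
    (hp : TorusPeriodic h) (j : Fin N) :
    ∫ x in cell N, lineDeriv ℝ h x (Pi.single j 1) = 0 := by
  obtain _ | n := N
  · exact j.elim0
  have hdiff : Differentiable ℝ h := hh.differentiable one_ne_zero
  have hcont : Continuous fun x => fderiv ℝ h x (Pi.single j 1) :=
    (hh.continuous_fderiv one_ne_zero).clm_apply continuous_const
  have hdiv := integral_divergence_of_hasFDerivAt_off_countable'
    (fun _ => -Real.pi) (fun _ => Real.pi) (fun _ => by linarith [Real.pi_pos])
    (Pi.single j h) (Pi.single j (fderiv ℝ h)) ∅ countable_empty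
    (fun i => by
      obtain rfl | hij := eq_or_ne i j
      · simpa using hh.continuous.continuousOn
      · rw [Pi.single_eq_of_ne hij]
        exact continuousOn_const)
    (fun x _ i => by
      obtain rfl | hij := eq_or_ne i j
      · simpa using (hdiff x).hasFDerivAt
      · simpa [hij] using hasFDerivAt_zero x)
  have hsum (x : Fin (n + 1) → ℝ) :
      ∑ i, Pi.single (M := fun _ => (Fin (n + 1) → ℝ) → (Fin (n + 1) → ℝ) →L[ℝ] ℂ) j
        (fderiv ℝ h) i x (Pi.single i 1) = lineDeriv ℝ h x (Pi.single j 1) := by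
    rw [(hdiff x).lineDeriv_eq_fderiv,
      Finset.sum_eq_single j (fun i _ hij => by simp [hij]) (by simp), Pi.single_eq_same]
  simp only [hsum] at hdiv
  have hint : IntegrableOn (fun x => lineDeriv ℝ h x (Pi.single j 1))
      (Icc (fun _ => -Real.pi) fun _ => Real.pi) := by
    simp only [(hdiff _).lineDeriv_eq_fderiv]
    exact hcont.continuousOn.integrableOn_compact isCompact_Icc
  rw [setIntegral_congr_set (cell_ae_eq_Icc (n + 1)), hdiv hint]
  refine Finset.sum_eq_zero fun i _ => ?_
  obtain rfl | hij := eq_or_ne i j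
  · have hfaces (x : Fin n → ℝ) : h (i.insertNth Real.pi x) = h (i.insertNth (-Real.pi) x) := by
      rw [← hp i (i.insertNth (-Real.pi) x), ← insertNth_add_eq_add_single, neg_add_eq_sub,
        two_mul, add_sub_cancel_right]
    simp [hfaces]
  · simp [hij]

/-- The character `x ↦ e^{inx}` of the torus. -/
def character (n : Fin N → ℤ) (x : Fin N → ℝ) : ℂ :=
  Complex.exp (Complex.I * ∑ j, (n j : ℂ) * (x j : ℂ))

lemma contDiff_character (n : Fin N → ℤ) {k : WithTop ℕ∞} : ContDiff ℝ k (character n) := by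
  refine (contDiff_const.mul (ContDiff.sum fun j _ => contDiff_const.mul ?_)).cexp
  exact Complex.ofRealCLM.contDiff.comp (contDiff_apply ℝ ℝ j)

lemma continuous_character (n : Fin N → ℤ) : Continuous (character n) :=
  (contDiff_character n (k := 0)).continuous

lemma character_add (n : Fin N → ℤ) (x y : Fin N → ℝ) :
    character n (x + y) = character n x * character n y := by
  simp only [character, Pi.add_apply, Complex.ofReal_add, mul_add, Finset.sum_add_distrib,
    Complex.exp_add]

lemma character_single (n : Fin N → ℤ) (j : Fin N) (t : ℝ) :
    character n (Pi.single j t) = Complex.exp (Complex.I * n j * t) := by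
  rw [character, Finset.sum_eq_single j (fun i _ hij => by simp [hij]) (by simp), Pi.single_eq_same,
    mul_assoc]

lemma torusPeriodic_character (n : Fin N → ℤ) : TorusPeriodic (character n) := fun j x => by
  have hperiod : Complex.exp (Complex.I * n j * (2 * Real.pi : ℝ)) = 1 :=
    Complex.exp_eq_one_iff.2 ⟨n j, by push_cast; ring⟩
  rw [character_add, character_single, hperiod, mul_one]

lemma character_mul_conj (n : Fin N → ℤ) (x : Fin N → ℝ) :
    character n x * starRingEnd ℂ (character n x) = 1 := by
  rw [character, ← Complex.exp_conj, ← Complex.exp_add]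
  simp

lemma torusInner_character_self (n : Fin N → ℤ) :
    torusInner (character n) (character n) = ((2 * Real.pi) ^ N : ℝ) := by
  simp only [torusInner, character_mul_conj, setIntegral_const, Measure.real, cell]
  rw [Real.volume_pi_Ioc_toReal fun _ => by linarith [Real.pi_pos]]
  simp [two_mul]

lemma hasLineDerivAt_character (n : Fin N → ℤ) (x : Fin N → ℝ) (j : Fin N) :
    HasLineDerivAt ℝ (character n) (Complex.I * n j * character n x) x (Pi.single j 1) := by
  have hline (t : ℝ) : character n (x + t • Pi.single j 1)
      = character n x * Complex.exp (t * (Complex.I * n j)) := by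
    rw [← Pi.single_smul, character_add, character_single, smul_eq_mul, mul_one,
      mul_comm (t : ℂ)]
  have hexp := ((hasDerivAt_id (0 : ℝ)).ofReal_comp.mul_const (Complex.I * n j)).cexp.const_mul
    (character n x)
  rw [HasLineDerivAt, funext hline]
  refine hexp.congr_deriv ?_
  simp [mul_comm]

lemma dOp_character (j : Fin N) (n : Fin N → ℤ) :
    dOp j (character n) = fun x => n j * character n x := by
  ext x
  rw [dOp, (hasLineDerivAt_character n x j).lineDeriv]
  linear_combination -(n j * character n x) * Complex.I_mul_I

/-- `g` is a function of class `C^k` on the torus. -/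
structure TorusContDiff (k : ℕ) (g : (Fin N → ℝ) → ℂ) : Prop where
  contDiff : ContDiff ℝ k g
  periodic : TorusPeriodic g

lemma torusContDiff_character (k : ℕ) (n : Fin N → ℤ) : TorusContDiff k (character n) :=
  ⟨contDiff_character n, torusPeriodic_character n⟩

namespace TorusContDiff

variable {k : ℕ} {g h : (Fin N → ℝ) → ℂ}

lemma mono {l : ℕ} (hg : TorusContDiff k g) (hl : l ≤ k) : TorusContDiff l g :=
  ⟨hg.contDiff.of_le (by exact_mod_cast hl), hg.periodic⟩

lemma mul_conj (hg : TorusContDiff k g) (hh : TorusContDiff k h) :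
    TorusContDiff k fun x => g x * starRingEnd ℂ (h x) :=
  ⟨hg.contDiff.mul (Complex.conjCLE.contDiff.comp hh.contDiff), fun j x => by
    simp only [hg.periodic j x, hh.periodic j x]⟩

lemma dOp (hg : TorusContDiff (k + 1) g) (j : Fin N) : TorusContDiff k (dOp j g) := by
  refine ⟨?_, fun i x => ?_⟩
  · have hdiff : Differentiable ℝ g := hg.contDiff.differentiable (by simp)
    have hfderiv : Subdiffusion.dOp j g = fun x => -Complex.I * fderiv ℝ g x (Pi.single j 1) := by
      ext x
      rw [Subdiffusion.dOp, (hdiff x).lineDeriv_eq_fderiv]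
    rw [hfderiv]
    exact contDiff_const.mul ((hg.contDiff.fderiv_right le_rfl).clm_apply contDiff_const)
  · have hshift (t : ℝ) : g (x + Pi.single i (2 * Real.pi) + t • Pi.single j 1)
        = g (x + t • Pi.single j 1) := by
      rw [add_right_comm]
      exact hg.periodic i _
    simp only [Subdiffusion.dOp, lineDeriv, hshift]

end TorusContDiff

end Torus

/-! ### The symbol as a Fourier multiplier -/

section Symbol

variable {N : ℕ} {g h : (Fin N → ℝ) → ℂ}

lemma torusInner_dOp (hg : TorusContDiff 1 g) (hh : TorusContDiff 1 h) (j : Fin N) :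
    torusInner (dOp j g) h = torusInner g (dOp j h) := by
  have hpoint (x : Fin N → ℝ) : dOp j g x * starRingEnd ℂ (h x) - g x * starRingEnd ℂ (dOp j h x)
      = -Complex.I * lineDeriv ℝ (fun y => g y * starRingEnd ℂ (h y)) x (Pi.single j 1) := by
    have hg' : HasLineDerivAt ℝ g (lineDeriv ℝ g x (Pi.single j 1)) x (Pi.single j 1) :=
      (hg.contDiff.differentiable one_ne_zero x).lineDifferentiableAt.hasLineDerivAt
    have hh' : HasLineDerivAt ℝ h (lineDeriv ℝ h x (Pi.single j 1)) x (Pi.single j 1) :=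
      (hh.contDiff.differentiable one_ne_zero x).lineDifferentiableAt.hasLineDerivAt
    have hprod : HasLineDerivAt ℝ (fun y => g y * starRingEnd ℂ (h y)) _ x (Pi.single j 1) :=
      HasDerivAt.mul hg' (HasDerivAt.star hh')
    rw [hprod.lineDeriv]
    simp only [dOp, zero_smul, add_zero, map_mul, map_neg, Complex.conj_I, ← starRingEnd_apply]
    ring
  have hcont (g' h' : (Fin N → ℝ) → ℂ) (hg' : TorusContDiff 0 g') (hh' : TorusContDiff 0 h') :
      IntegrableOn (fun x => g' x * starRingEnd ℂ (h' x)) (cell N) :=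
    integrableOn_cell (hg'.mul_conj hh').contDiff.continuous
  rw [← sub_eq_zero, torusInner, torusInner,
    ← integral_sub (hcont _ _ (hg.dOp j) (hh.mono zero_le_one))
      (hcont _ _ (hg.mono zero_le_one) (hh.dOp j))]
  simp only [hpoint]
  rw [integral_const_mul, integral_lineDeriv_eq_zero (hg.mul_conj hh).contDiff
    (hg.mul_conj hh).periodic, mul_zero]

lemma torusInner_const_mul_right (c : ℂ) (g h : (Fin N → ℝ) → ℂ) :
    torusInner g (fun x => c * h x) = starRingEnd ℂ c * torusInner g h := by
  simp only [torusInner, map_mul, mul_left_comm _ (starRingEnd ℂ c), integral_const_mul]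

lemma torusInner_dOp_character (hg : TorusContDiff 1 g) (n : Fin N → ℤ) (j : Fin N) :
    torusInner (dOp j g) (character n) = n j * torusInner g (character n) := by
  rw [torusInner_dOp hg (torusContDiff_character 1 n), dOp_character, torusInner_const_mul_right,
    map_intCast]

namespace TorusContDiff

lemma dOp_iterate {k r : ℕ} (hg : TorusContDiff (k + r) g) (j : Fin N) :
    TorusContDiff k ((Subdiffusion.dOp j)^[r] g) := by
  induction r generalizing g with
  | zero => exact hg
  | succ r ih => exact ih (hg.dOp j)

lemma foldr_dOp {k : ℕ} (α : Fin N → ℕ) (l : List (Fin N))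
    (hg : TorusContDiff (k + (l.map α).sum) g) :
    TorusContDiff k (l.foldr (fun j h => (Subdiffusion.dOp j)^[α j] h) g) := by
  induction l generalizing k with
  | nil => exact hg
  | cons j l ih => exact (ih (by simpa [add_assoc] using hg)).dOp_iterate j

end TorusContDiff

lemma torusInner_dOp_iterate_character {r : ℕ} (hg : TorusContDiff r g) (n : Fin N → ℤ)
    (j : Fin N) :
    torusInner ((dOp j)^[r] g) (character n) = (n j : ℂ) ^ r * torusInner g (character n) := by
  induction r generalizing g with
  | zero => simp
  | succ r ih =>
    rw [Function.iterate_succ_apply, ih (hg.dOp j), torusInner_dOp_character (hg.mono (by simp)),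
      pow_succ, mul_assoc]

lemma torusInner_foldr_dOp_character (α : Fin N → ℕ) (l : List (Fin N))
    (hg : TorusContDiff (l.map α).sum g) (n : Fin N → ℤ) :
    torusInner (l.foldr (fun j h => (dOp j)^[α j] h) g) (character n)
      = (l.map fun j => (n j : ℂ) ^ α j).prod * torusInner g (character n) := by
  induction l with
  | nil => simp
  | cons j l ih =>
    rw [List.foldr_cons, torusInner_dOp_iterate_character (TorusContDiff.foldr_dOp α l hg),
      ih (hg.mono (by simp)), List.map_cons, List.prod_cons, mul_assoc]

lemma sum_map_finRange_of_mem_multiIndices {m : ℕ} {α : Fin N → ℕ} (hα : α ∈ multiIndices N m) :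
    ((List.finRange N).map α).sum = m := by
  rw [← Fin.sum_univ_def]
  exact (Finset.mem_piAntidiag.1 hα).1

lemma TorusContDiff.continuous_dPow {m : ℕ} {α : Fin N → ℕ} (hg : TorusContDiff m g)
    (hα : α ∈ multiIndices N m) : Continuous (dPow α g) :=
  (TorusContDiff.foldr_dOp (k := 0) α (List.finRange N)
    (by rwa [sum_map_finRange_of_mem_multiIndices hα, zero_add])).contDiff.continuous

lemma torusInner_dPow_character {m : ℕ} {α : Fin N → ℕ} (hg : TorusContDiff m g)
    (hα : α ∈ multiIndices N m) (n : Fin N → ℤ) :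
    torusInner (dPow α g) (character n) = (∏ j, (n j : ℂ) ^ α j) * torusInner g (character n) := by
  rw [Fin.prod_univ_def]
  exact torusInner_foldr_dOp_character α _
    (by rwa [sum_map_finRange_of_mem_multiIndices hα]) n

lemma torusInner_diffOp_character {m : ℕ} (a : (Fin N → ℕ) → ℂ) (hg : TorusContDiff m g)
    (n : Fin N → ℤ) :
    torusInner (diffOp m a g) (character n)
      = symbol m a (fun j => n j) * torusInner g (character n) := by
  have hint (α) (hα : α ∈ multiIndices N m) :
      IntegrableOn (fun x => a α * (dPow α g x * starRingEnd ℂ (character n x))) (cell N) :=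
    (integrableOn_cell
      (continuous_mul_conj (hg.continuous_dPow hα) (continuous_character n))).const_mul _
  calc torusInner (diffOp m a g) (character n)
      = ∑ α ∈ multiIndices N m, a α * torusInner (dPow α g) (character n) := by
        simp only [torusInner, diffOp, Finset.sum_mul, mul_assoc]
        rw [integral_finsetSum _ hint]
        simp only [integral_const_mul]
    _ = ∑ α ∈ multiIndices N m, a α * ((∏ j, (n j : ℂ) ^ α j) * torusInner g (character n)) :=
        Finset.sum_congr rfl fun α hα => by rw [torusInner_dPow_character hg hα]
    _ = symbol m a (fun j => n j) * torusInner g (character n) := by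
        simp only [symbol, Finset.sum_mul, mul_assoc, Complex.ofReal_intCast]

theorem IsSymmetricOp.exists_symbol_eq_ofReal {m : ℕ} {a : (Fin N → ℕ) → ℂ}
    (hsymm : IsSymmetricOp m a) (n : Fin N → ℤ) :
    ∃ lam : ℝ, symbol m a (fun j => n j) = lam := by
  have hself := hsymm (character n) (character n) (contDiff_character n)
    (torusPeriodic_character n) (contDiff_character n) (torusPeriodic_character n)
  rw [← conj_torusInner (diffOp m a (character n)),
    torusInner_diffOp_character a (torusContDiff_character m n), torusInner_character_self, map_mul,
    Complex.conj_ofReal] at hself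
  have hne : (((2 * Real.pi) ^ N : ℝ) : ℂ) ≠ 0 := Complex.ofReal_ne_zero.2 (by positivity)
  exact ⟨_, (Complex.conj_eq_iff_re.1 (mul_right_cancel₀ hne hself).symm).symm⟩

end Symbol

section FourierUniqueness

variable {N : ℕ} {g h : (Fin N → ℝ) → ℂ}

lemma TorusPeriodic.periodic_two_pi_mul (hp : TorusPeriodic g) (k : Fin N → ℤ) :
    Function.Periodic g fun j => 2 * Real.pi * k j := by
  have hpartial (s : Finset (Fin N)) :
      Function.Periodic g (∑ j ∈ s, k j • (Pi.single j (2 * Real.pi) : Fin N → ℝ)) := by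
    induction s using Finset.induction_on with
    | empty => exact fun x => by simp
    | insert j s hj ih =>
      rw [Finset.sum_insert hj]
      exact ((hp j).zsmul (k j)).add_period ih
  convert hpartial Finset.univ using 1
  ext i
  rw [Finset.sum_apply, Finset.sum_eq_single i (fun j _ hj => by simp [hj.symm]) (by simp)]
  simp [mul_comm]

lemma TorusPeriodic.exists_unitAddTorus_lift (hg : Continuous g) (hp : TorusPeriodic g) :
    ∃ G : C(UnitAddTorus (Fin N), ℂ),
      ∀ x : Fin N → ℝ, G (fun i => (x i : UnitAddCircle)) = g ((2 * Real.pi) • x) := by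
  let q : C(Fin N → ℝ, UnitAddTorus (Fin N)) := ⟨fun x i => (x i : UnitAddCircle), by fun_prop⟩
  have hq : IsQuotientMap q :=
    (IsOpenQuotientMap.piMap fun _ : Fin N => QuotientAddGroup.isOpenQuotientMap_mk
      (N := AddSubgroup.zmultiples (1 : ℝ))).isQuotientMap
  let gScaled : C(Fin N → ℝ, ℂ) := ⟨fun x => g ((2 * Real.pi) • x), by fun_prop⟩
  have hfac : Function.FactorsThrough gScaled q := by
    intro x y hxy
    have hshift (i : Fin N) : ∃ k : ℤ, x i = y i + k := by
      have hzero : ((x i - y i : ℝ) : UnitAddCircle) = 0 := by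
        rw [AddCircle.coe_sub, sub_eq_zero]
        exact congrFun hxy i
      obtain ⟨k, hk⟩ := (AddCircle.coe_eq_zero_iff (1 : ℝ)).1 hzero
      exact ⟨k, by rw [zsmul_one] at hk; linarith⟩
    choose k hk using hshift
    calc g ((2 * Real.pi) • x) = g ((2 * Real.pi) • y + fun j => 2 * Real.pi * k j) := by
          congr 1
          ext i
          simp [hk i, mul_add]
      _ = g ((2 * Real.pi) • y) := hp.periodic_two_pi_mul k _
  exact ⟨hq.lift gScaled hfac, DFunLike.congr_fun (hq.lift_comp gScaled hfac)⟩

open scoped Pointwise in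
lemma two_pi_smul_Ioc_eq_cell (N : ℕ) :
    (2 * Real.pi) • {x : Fin N → ℝ | ∀ i, x i ∈ Ioc (-1 / 2 : ℝ) (-1 / 2 + 1)} = cell N := by
  ext x
  rw [Set.mem_smul_set_iff_inv_smul_mem₀ (by positivity)]
  simp only [mem_ofPred_eq, Pi.smul_apply, smul_eq_mul, cell, mem_univ_pi, mem_Ioc]
  refine forall_congr' fun i => and_congr ?_ ?_
  · rw [lt_inv_mul_iff₀ (by positivity), show 2 * Real.pi * (-1 / 2) = -Real.pi by ring]
  · rw [inv_mul_le_iff₀ (by positivity), show 2 * Real.pi * (-1 / 2 + 1) = Real.pi by ring]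

lemma mFourier_neg_eq_conj_character (n : Fin N → ℤ) (x : Fin N → ℝ) :
    UnitAddTorus.mFourier (-n) (fun i => (x i : UnitAddCircle))
      = starRingEnd ℂ (character n ((2 * Real.pi) • x)) := by
  simp only [UnitAddTorus.mFourier, ContinuousMap.coe_mk, fourier_coe_apply, character]
  rw [← Complex.exp_sum, ← Complex.exp_conj, Finset.mul_sum, map_sum]
  refine congrArg Complex.exp (Finset.sum_congr rfl fun i _ => ?_)
  simp [map_ofNat]
  ring

lemma mFourierCoeff_eq_smul_torusInner {G : C(UnitAddTorus (Fin N), ℂ)}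
    (hG : ∀ x : Fin N → ℝ, G (fun i => (x i : UnitAddCircle)) = g ((2 * Real.pi) • x))
    (n : Fin N → ℤ) :
    UnitAddTorus.mFourierCoeff G n = ((2 * Real.pi) ^ N)⁻¹ • torusInner g (character n) := by
  rw [UnitAddTorus.mFourierCoeff_eq_integral G n fun _ => -1 / 2]
  simp only [hG, mFourier_neg_eq_conj_character, smul_eq_mul, mul_comm (starRingEnd ℂ _)]
  rw [Measure.setIntegral_comp_smul_of_pos volume
    (fun y => g y * starRingEnd ℂ (character n y)) _ (by positivity), two_pi_smul_Ioc_eq_cell,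
    Module.finrank_fin_fun, torusInner]

theorem eq_zero_of_torusInner_character_eq_zero (hg : Continuous g) (hp : TorusPeriodic g)
    (hzero : ∀ n, torusInner g (character n) = 0) : g = 0 := by
  obtain ⟨G, hG⟩ := hp.exists_unitAddTorus_lift hg
  have hcoeff : UnitAddTorus.mFourierCoeff G = 0 := by
    ext n
    rw [mFourierCoeff_eq_smul_torusInner hG, hzero, smul_zero, Pi.zero_apply]
  have hsum (y : UnitAddTorus (Fin N)) : G y = 0 := by
    have hseries := UnitAddTorus.hasSum_mFourier_series_apply_of_summable (f := G)
      (hcoeff ▸ summable_zero) y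
    rw [hcoeff] at hseries
    exact hseries.unique (by simp)
  ext x
  rw [← smul_inv_smul₀ (show 2 * Real.pi ≠ 0 by positivity) x, ← hG, hsum, Pi.zero_apply]

theorem eq_of_torusInner_character_eq (hg : Continuous g) (hgp : TorusPeriodic g)
    (hh : Continuous h) (hhp : TorusPeriodic h)
    (heq : ∀ n, torusInner g (character n) = torusInner h (character n)) : g = h := by
  have hzero := eq_zero_of_torusInner_character_eq_zero (g := fun x => g x - h x) (hg.sub hh)
    (fun j x => by simp only [hgp j x, hhp j x])
    fun n => by rw [torusInner_sub hg hh (continuous_character n), heq, sub_self]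
  exact funext fun x => sub_eq_zero.1 (congrFun hzero x)

end FourierUniqueness

section TimeDependence

variable {N : ℕ} {F : (Fin N → ℝ) → ℝ → ℂ} {h : (Fin N → ℝ) → ℂ}

lemma continuousOn_torusInner {s : Set ℝ} [LocallyCompactSpace s]
    (hF : ContinuousOn (fun p : (Fin N → ℝ) × ℝ => F p.1 p.2) (univ ×ˢ s)) (hh : Continuous h) :
    ContinuousOn (fun t => torusInner (fun x => F x t) h) s := by
  rw [continuousOn_iff_continuous_domRestrict]
  have hcont : Continuous fun p : s × (Fin N → ℝ) => F p.2 p.1 * starRingEnd ℂ (h p.2) :=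
    continuous_mul_conj
      (hF.comp_continuous (f := fun p : s × (Fin N → ℝ) => (p.2, (p.1 : ℝ))) (by fun_prop)
        fun p => ⟨mem_univ _, p.1.2⟩)
      (hh.comp continuous_snd)
  simp only [torusInner, setIntegral_congr_set (cell_ae_eq_Icc N)]
  exact continuous_parametric_integral_of_continuous hcont isCompact_Icc

lemma integrable_smul_prod_cell {a b : ℝ}
    (hF : ContinuousOn (fun p : (Fin N → ℝ) × ℝ => F p.1 p.2) (univ ×ˢ Icc a b)) {k : ℝ → ℝ}
    (hk : IntegrableOn k (Ioc a b)) :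
    Integrable (Function.uncurry fun x s => k s • F x s)
      ((volume.restrict (cell N)).prod (volume.restrict (Ioc a b))) := by
  have hfinite : IsFiniteMeasure (volume.restrict (cell N)) := isFiniteMeasure_restrict.2
    ((measure_mono (cell_subset_Icc N)).trans_lt isCompact_Icc.measure_lt_top).ne
  have hF' := hF.mono (prod_mono_left (subset_univ (Icc (fun _ => -Real.pi) fun _ => Real.pi)))
  obtain ⟨M, hM⟩ := (isCompact_Icc.prod isCompact_Icc).exists_bound_of_continuousOn hF'
  have hsub : cell N ×ˢ Ioc a b ⊆ Icc (fun _ => -Real.pi) (fun _ => Real.pi) ×ˢ Icc a b :=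
    prod_mono (cell_subset_Icc N) Ioc_subset_Icc_self
  have hmeas : MeasurableSet (cell N ×ˢ Ioc a b) := (measurableSet_cell N).prod measurableSet_Ioc
  refine (hk.comp_snd (volume.restrict (cell N))).smul_bdd M ?_ ?_ <;> rw [Measure.prod_restrict]
  · exact (hF'.mono hsub).aestronglyMeasurable hmeas
  · filter_upwards [ae_restrict_mem hmeas] with p hp using hM p (hsub hp)

lemma torusInner_integral_smul {a b : ℝ} (hab : a ≤ b)
    (hF : ContinuousOn (fun p : (Fin N → ℝ) × ℝ => F p.1 p.2) (univ ×ˢ Icc a b)) {k : ℝ → ℝ}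
    (hk : IntervalIntegrable k volume a b) (hh : Continuous h) :
    torusInner (fun x => ∫ s in a..b, k s • F x s) h
      = ∫ s in a..b, k s • torusInner (fun x => F x s) h := by
  have hint := integrable_smul_prod_cell (F := fun x s => F x s * starRingEnd ℂ (h x))
    (hF.mul (Complex.continuous_conj.comp (hh.comp continuous_fst)).continuousOn)
    ((intervalIntegrable_iff_integrableOn_Ioc_of_le hab).1 hk)
  simp only [torusInner, intervalIntegral.integral_of_le hab, ← integral_mul_const, smul_mul_assoc,
    ← integral_smul]
  exact integral_integral_swap hint

lemma torusInner_smul (r : ℝ) (g h : (Fin N → ℝ) → ℂ) :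
    torusInner (fun x => r • g x) h = r • torusInner g h := by
  simp only [torusInner, smul_mul_assoc, integral_smul]

lemma torusInner_fracInt {a t : ℝ} (ha : 0 ≤ a) (ht : 0 ≤ t)
    (hF : ContinuousOn (fun p : (Fin N → ℝ) × ℝ => F p.1 p.2) (univ ×ˢ Icc 0 t))
    (hh : Continuous h) :
    torusInner (fun x => fracInt a (F x) t) h
      = fracInt a (fun s => torusInner (fun x => F x s) h) t := by
  obtain rfl | ha := ha.eq_or_lt
  · simp only [fracInt_zero]
  · simp only [fracInt_of_ne ha.ne', torusInner_smul,
      torusInner_integral_smul ht hF (intervalIntegrable_rpow_sub ha 0 t) hh]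

end TimeDependence

/-! ### The inverse problem -/

section Uniqueness

/-- The coefficient of `u (·, t)` along the character `e^{inx}`, as a function of the time `t`.
It is `(2π)^N` times the usual Fourier coefficient. -/
def fourierMode {N : ℕ} (n : Fin N → ℤ) (u : (Fin N → ℝ) → ℝ → ℂ) (t : ℝ) : ℂ :=
  torusInner (fun x => u x t) (character n)

namespace IsClassicalSolution

variable {N m : ℕ} {a : (Fin N → ℕ) → ℂ} {ρ T : ℝ} {φ Ψ : (Fin N → ℝ) → ℂ}
  {u : (Fin N → ℝ) → ℝ → ℂ} {f : (Fin N → ℝ) → ℂ}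

lemma continuous_space (h : IsClassicalSolution m a ρ T φ Ψ u f) {t : ℝ} (ht : t ∈ Icc 0 T) :
    Continuous fun x => u x t :=
  h.u_continuous.comp_continuous (f := fun x => (x, t)) (by fun_prop) fun _ => ⟨mem_univ _, ht⟩

lemma continuousOn_fourierMode (h : IsClassicalSolution m a ρ T φ Ψ u f) (n : Fin N → ℤ) :
    ContinuousOn (fourierMode n u) (Icc 0 T) :=
  continuousOn_torusInner h.u_continuous (continuous_character n)

lemma continuousOn_sub_initial (h : IsClassicalSolution m a ρ T φ Ψ u f) (hT : 0 ≤ T) :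
    ContinuousOn (fun p : (Fin N → ℝ) × ℝ => u p.1 p.2 - u p.1 0) (univ ×ˢ Icc 0 T) :=
  h.u_continuous.sub
    ((h.continuous_space (left_mem_Icc.2 hT)).comp continuous_fst).continuousOn

lemma torusInner_caputoDeriv_character (h : IsClassicalSolution m a ρ T φ Ψ u f)
    (n : Fin N → ℤ) {t : ℝ} (ht : t ∈ Ioc 0 T) :
    torusInner (fun x => caputoDeriv ρ T (u x) t) (character n)
      = torusInner f (character n) - symbol m a (fun j => n j) * fourierMode n u t := by
  have hcont : Continuous (diffOp m a fun y => u y t) :=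
    h.diffOp_continuous.comp_continuous (f := fun x => (x, t)) (by fun_prop)
      fun _ => ⟨mem_univ _, ht⟩
  have hequation : (fun x => caputoDeriv ρ T (u x) t)
      = fun x => f x - diffOp m a (fun y => u y t) x :=
    funext fun x => eq_sub_of_add_eq (h.equation x t ht)
  rw [hequation, torusInner_sub h.f_continuous hcont (continuous_character n),
    torusInner_diffOp_character a ⟨h.u_contDiff t ht, h.u_periodic t (Ioc_subset_Icc_self ht)⟩,
    fourierMode]

lemma torusInner_fracInt_sub_initial (h : IsClassicalSolution m a ρ T φ Ψ u f) (hρ' : ρ ≤ 1)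
    (n : Fin N → ℤ) {t : ℝ} (ht : t ∈ Icc 0 T) :
    torusInner (fun x => fracInt (1 - ρ) (fun s => u x s - u x 0) t) (character n)
      = fracInt (1 - ρ) (fun s => fourierMode n u s - fourierMode n u 0) t := by
  have hsub : Icc 0 t ⊆ Icc 0 T := Icc_subset_Icc_right ht.2
  have hT : 0 ≤ T := ht.1.trans ht.2
  rw [torusInner_fracInt (F := fun x s => u x s - u x 0) (sub_nonneg.2 hρ') ht.1
    ((h.continuousOn_sub_initial hT).mono (prod_mono_right hsub)) (continuous_character n)]
  exact fracInt_congr ht.1 fun s hs => torusInner_sub (h.continuous_space (hsub hs))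
    (h.continuous_space (left_mem_Icc.2 hT)) (continuous_character n)

lemma fracInt_fourierMode_sub (h : IsClassicalSolution m a ρ T φ Ψ u f) (hρ' : ρ ≤ 1)
    (n : Fin N → ℤ) {ε t : ℝ} (hε : 0 < ε) (hεt : ε ≤ t) (htT : t ≤ T) :
    fracInt (1 - ρ) (fun s => fourierMode n u s - fourierMode n u 0) t
        - fracInt (1 - ρ) (fun s => fourierMode n u s - fourierMode n u 0) ε
      = ∫ s in ε..t,
          (torusInner f (character n) - symbol m a (fun j => n j) * fourierMode n u s) := by
  have ht : t ∈ Icc 0 T := ⟨hε.le.trans hεt, htT⟩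
  have hε' : ε ∈ Icc 0 T := ⟨hε.le, hεt.trans htT⟩
  have hsub : Icc ε t ⊆ Ioc 0 T := fun s hs => ⟨hε.trans_le hs.1, hs.2.trans htT⟩
  have hcont {r : ℝ} (hr : r ∈ Icc 0 T) :
      Continuous fun x => fracInt (1 - ρ) (fun s => u x s - u x 0) r :=
    (continuousOn_fracInt (F := fun x s => u x s - u x 0) (sub_nonneg.2 hρ')
      (h.continuousOn_sub_initial (hr.1.trans hr.2))).comp_continuous (f := fun x => (x, r))
      (by fun_prop) fun _ => ⟨mem_univ _, hr⟩
  have hcaputo (x : Fin N → ℝ) : fracInt (1 - ρ) (fun s => u x s - u x 0) t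
      - fracInt (1 - ρ) (fun s => u x s - u x 0) ε
      = ∫ s in ε..t, (1 : ℝ) • caputoDeriv ρ T (u x) s := by
    simp only [one_smul]
    exact (integral_caputoDeriv_eq_sub hρ' hε hεt htT (h.caputo_exists x)
      (h.caputo_continuous.comp (f := fun s => (x, s)) (by fun_prop)
        fun s hs => ⟨mem_univ _, hs⟩)).symm
  rw [← h.torusInner_fracInt_sub_initial hρ' n ht, ← h.torusInner_fracInt_sub_initial hρ' n hε',
    ← torusInner_sub (hcont ht) (hcont hε') (continuous_character n)]
  simp only [hcaputo]
  rw [torusInner_integral_smul (F := fun x s => caputoDeriv ρ T (u x) s) hεt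
    (h.caputo_continuous.mono (prod_mono_right hsub)) intervalIntegrable_const
    (continuous_character n)]
  refine intervalIntegral.integral_congr fun s hs => ?_
  rw [uIcc_of_le hεt] at hs
  simp only [one_smul, h.torusInner_caputoDeriv_character n (hsub hs)]

lemma fracInt_fourierMode_eq_integral (h : IsClassicalSolution m a ρ T φ Ψ u f) (hρ' : ρ ≤ 1)
    (n : Fin N → ℤ) {t : ℝ} (ht : t ∈ Icc 0 T) :
    fracInt (1 - ρ) (fun s => fourierMode n u s - fourierMode n u 0) t
      = ∫ s in (0 : ℝ)..t,
          (torusInner f (character n) - symbol m a (fun j => n j) * fourierMode n u s) := by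
  set J := fracInt (1 - ρ) fun s => fourierMode n u s - fourierMode n u 0
  have hY : ContinuousOn (fourierMode n u) (Icc 0 t) :=
    (h.continuousOn_fourierMode n).mono (Icc_subset_Icc_right ht.2)
  have hJ : ContinuousOn J (Icc 0 t) :=
    continuousOn_fracInt_of_continuousOn (sub_nonneg.2 hρ') (hY.sub continuousOn_const)
  have hJ0 : J 0 = 0 := by simp [J, fracInt]
  set K : ℝ → ℂ := fun ε => ∫ s in ε..t,
    (torusInner f (character n) - symbol m a (fun j => n j) * fourierMode n u s)
  have hK : ContinuousOn K (Icc 0 t) := by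
    have hprimitive := intervalIntegral.continuousOn_primitive_interval_left (a := 0) (b := t)
      (μ := volume) (f := fun s =>
        torusInner f (character n) - symbol m a (fun j => n j) * fourierMode n u s)
      (by rw [uIcc_of_le ht.1]; exact ContinuousOn.integrableOn_Icc (by fun_prop))
    rwa [uIcc_of_le ht.1] at hprimitive
  obtain h0 | h0 := ht.1.eq_or_lt
  · simp [← h0, hJ0]
  have heq : EqOn (fun ε => J t - J ε) K (Ioc 0 t) := fun ε hε =>
    h.fracInt_fourierMode_sub hρ' n hε.1 hε.2 ht.2
  have heq0 := heq.of_subset_closure (continuousOn_const.sub hJ) hK Ioc_subset_Icc_self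
    (closure_Ioc h0.ne).ge (left_mem_Icc.2 ht.1)
  simpa only [hJ0, sub_zero] using heq0

theorem fourierMode_eq_fracInt (h : IsClassicalSolution m a ρ T φ Ψ u f) (hρ : 0 < ρ)
    (hρ' : ρ ≤ 1) (hT : 0 < T) (n : Fin N → ℤ) {t : ℝ} (ht : t ∈ Icc 0 T) :
    fourierMode n u t - fourierMode n u 0 = fracInt ρ (fun s =>
      torusInner f (character n) - symbol m a (fun j => n j) * fourierMode n u s) t := by
  have hY := h.continuousOn_fourierMode n
  exact eqOn_fracInt_of_fracInt_eq_integral hρ.le hρ' hT (hY.sub continuousOn_const)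
    (by fun_prop) (fun s hs => h.fracInt_fourierMode_eq_integral hρ' n hs) ht

lemma fourierMode_zero (h : IsClassicalSolution m a ρ T φ Ψ u f) (n : Fin N → ℤ) :
    fourierMode n u 0 = torusInner φ (character n) := by
  simp only [fourierMode, h.initial]

lemma fourierMode_final (h : IsClassicalSolution m a ρ T φ Ψ u f) (n : Fin N → ℤ) :
    fourierMode n u T = torusInner Ψ (character n) := by
  simp only [fourierMode, h.final]

variable {u₁ u₂ : (Fin N → ℝ) → ℝ → ℂ} {f₁ f₂ : (Fin N → ℝ) → ℂ}

theorem fourierMode_unique (hsymm : IsSymmetricOp m a) (hρ : 0 < ρ) (hρ' : ρ ≤ 1) (hT : 0 < T)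
    (h₁ : IsClassicalSolution m a ρ T φ Ψ u₁ f₁) (h₂ : IsClassicalSolution m a ρ T φ Ψ u₂ f₂)
    (n : Fin N → ℤ) :
    torusInner f₁ (character n) = torusInner f₂ (character n) ∧
      EqOn (fourierMode n u₁) (fourierMode n u₂) (Icc 0 T) := by
  obtain ⟨lam, hlam⟩ := hsymm.exists_symbol_eq_ofReal n
  have hY₁ := h₁.continuousOn_fourierMode n
  have hY₂ := h₂.continuousOn_fourierMode n
  have hdiff (t) (ht : t ∈ Icc 0 T) : fourierMode n u₁ t - fourierMode n u₂ t
      = fracInt ρ (fun s => torusInner f₁ (character n) - torusInner f₂ (character n)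
          - lam • (fourierMode n u₁ s - fourierMode n u₂ s)) t := by
    have hY₁' := hY₁.mono (Icc_subset_Icc_right ht.2)
    have hY₂' := hY₂.mono (Icc_subset_Icc_right ht.2)
    calc fourierMode n u₁ t - fourierMode n u₂ t
        = fourierMode n u₁ t - fourierMode n u₁ 0
            - (fourierMode n u₂ t - fourierMode n u₂ 0) := by
          rw [h₁.fourierMode_zero, h₂.fourierMode_zero, sub_sub_sub_cancel_right]
      _ = _ := by
          rw [h₁.fourierMode_eq_fracInt hρ hρ' hT n ht, h₂.fourierMode_eq_fracInt hρ hρ' hT n ht,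
            ← fracInt_sub hρ.le ht.1 (by fun_prop) (by fun_prop)]
          refine fracInt_congr ht.1 fun s _ => ?_
          simp only [hlam, Complex.real_smul]
          ring
  have hend : fourierMode n u₁ T - fourierMode n u₂ T = 0 := by
    rw [h₁.fourierMode_final, h₂.fourierMode_final, sub_self]
  exact ⟨sub_eq_zero.1 (eq_zero_of_eq_fracInt_of_endpoint hρ hρ' hT (hY₁.sub hY₂) hdiff hend),
    fun t ht => sub_eq_zero.1
      (eqOn_zero_of_eq_fracInt_of_endpoint hρ hρ' hT (hY₁.sub hY₂) hdiff hend ht)⟩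

end IsClassicalSolution

end Uniqueness

end Subdiffusion

end

open Subdiffusion in
theorem theorem3p1_general {N m : ℕ} {a : (Fin N → ℕ) → ℂ} (hsymm : IsSymmetricOp m a) {ρ T : ℝ}
    (hρ : 0 < ρ) (hρ' : ρ ≤ 1) (hT : 0 < T) {φ Ψ : (Fin N → ℝ) → ℂ}
    {u₁ u₂ : (Fin N → ℝ) → ℝ → ℂ} {f₁ f₂ : (Fin N → ℝ) → ℂ}
    (h₁ : IsClassicalSolution m a ρ T φ Ψ u₁ f₁) (h₂ : IsClassicalSolution m a ρ T φ Ψ u₂ f₂) :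
    (∀ x, ∀ t ∈ Icc 0 T, u₁ x t = u₂ x t) ∧ f₁ = f₂ := by
  have hmodes := h₁.fourierMode_unique hsymm hρ hρ' hT h₂
  constructor
  · intro x t ht
    have htime : (fun x => u₁ x t) = fun x => u₂ x t :=
      eq_of_torusInner_character_eq (h₁.continuous_space ht) (h₁.u_periodic t ht)
        (h₂.continuous_space ht) (h₂.u_periodic t ht) fun n => (hmodes n).2 ht
    exact congrFun htime x
  · exact eq_of_torusInner_character_eq h₁.f_continuous h₁.f_periodic h₂.f_continuous
      h₂.f_periodic fun n => (hmodes n).1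

theorem theorem3p1 {N : ℕ} (hN : 1 ≤ N) (m : ℕ) (a : (Fin N → ℕ) → ℂ)
    (hell : Subdiffusion.IsElliptic m a)
    (hsymm : Subdiffusion.IsSymmetricOp m a)
    (hpos : Subdiffusion.IsPositiveOp m a)
    (ρ T : ℝ) (hρ : 0 < ρ) (hρ' : ρ ≤ 1) (hT : 0 < T)
    (φ Ψ : (Fin N → ℝ) → ℂ)
    (hφ : Continuous φ) (hφp : Subdiffusion.TorusPeriodic φ)
    (hΨ : Continuous Ψ) (hΨp : Subdiffusion.TorusPeriodic Ψ)
    (u₁ u₂ : (Fin N → ℝ) → ℝ → ℂ) (f₁ f₂ : (Fin N → ℝ) → ℂ)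
    (h₁ : Subdiffusion.IsClassicalSolution m a ρ T φ Ψ u₁ f₁)
    (h₂ : Subdiffusion.IsClassicalSolution m a ρ T φ Ψ u₂ f₂) :
    (∀ x, ∀ t ∈ Set.Icc 0 T, u₁ x t = u₂ x t) ∧ f₁ = f₂ :=
  theorem3p1_general hsymm hρ hρ' hT h₁ h₂
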